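/- Theorem 1.3 (improved heat flow estimate, periodic case). Let $\mathbb T^d=\mathbb R^d/\mathbb Z^d$ with Lebesgue measure, and for $f\in L^1(\mathbb T^d)$ let $\hat f(n)=\int_{\mathbb T^d}f(x)e^{-2\pi i n\cdot x}\,dx$, $n\in\mathbb Z^d$; $f$ has mean zero if $\hat f(0)=0$. For $0<\alpha\le 2$ and $t>0$ let $e^{-t|\nabla|^\alpha}f$ be the function with Fourier series $$e^{-t|\nabla|^\alpha}f(x)=\sum_{n\in\mathbb Z^d}e^{-t(2\pi|n|)^\alpha}\hat f(n)e^{2\pi i n\cdot x},$$ where $|n|$ is the Euclidean norm, and write $e^{t\Delta}=e^{-t|\nabla|^2}$. (1) For every $d\ge 1$ and every $0<\alpha<2$ there is a constant $c_1>0$, depending only on $(\alpha,d)$, such that for every $1\le q\le\infty$ and every $f\in L^q(\mathbb T^d)$ with mean zero, $$\|e^{-t|\nabla|^\alpha}f\|_{L^q(\mathbb T^d)}\le e^{-c_1t}\|f\|_{L^q(\mathbb T^d)}\qquad\text{for all }t>0.$$ (2) There is an absolute constant $c_2>0$ such that for every $d\ge 1$, every $1<q<\infty$ and every $f\in L^q(\mathbb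 T^d)$ with mean zero, $$\|e^{t\Delta}f\|_{L^q(\mathbb T^d)}\le e^{-c_2\frac{q-1}{q^2}t}\|f\|_{L^q(\mathbb T^d)}\qquad\text{for all }t>0.$$ -/

import Mathlib

open MeasureTheory
open scoped ENNReal

namespace PeriodicHeat

/-- Lebesgue measure on the torus `ℝᵈ/ℤᵈ`, as the product of the probability Haar measures on the
factors. It is the measure against which `UnitAddTorus.mFourierCoeff` integrates. -/
noncomputable def torusMeasure (d : ℕ) : Measure (UnitAddTorus (Fin d)) :=
  Measure.pi fun _ => AddCircle.haarAddCircle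

theorem torusMeasure_eq_volume (d : ℕ) : torusMeasure d = volume := by
  have h : (volume : Measure UnitAddCircle) = AddCircle.haarAddCircle := by
    have := AddCircle.volume_eq_smul_haarAddCircle (T := 1)
    simpa using this
  simp only [torusMeasure, volume_pi, h]

/-- The Euclidean length `|n|` of a frequency `n ∈ ℤᵈ`. -/
noncomputable def freqNorm {d : ℕ} (n : Fin d → ℤ) : ℝ :=
  Real.sqrt (∑ i, (n i : ℝ) ^ 2)

/-- The Fourier multiplier `e^{-t (2π|n|)^α}` of `e^{-t|∇|^α}`. -/
noncomputable def heatSymbol {d : ℕ} (α t : ℝ) (n : Fin d → ℤ) : ℝ :=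
  Real.exp (-(t * (2 * Real.pi * freqNorm n) ^ α))

/-- The function `e^{-t|∇|^α} f`, given by its Fourier series
`∑ₙ e^{-t (2π|n|)^α} f̂(n) e^{2πi n·x}`. For `α, t > 0` and any `f` the series converges
absolutely, uniformly in `x`. For `α = 2` this is `e^{tΔ} f`. -/
noncomputable def fracHeat {d : ℕ} (α t : ℝ) (f : UnitAddTorus (Fin d) → ℂ) :
    UnitAddTorus (Fin d) → ℂ := fun x =>
  ∑' n : Fin d → ℤ,
    (heatSymbol α t n : ℂ) * UnitAddTorus.mFourierCoeff f n * UnitAddTorus.mFourier n x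

theorem heatSymbol_pos {d : ℕ} (α t : ℝ) (n : Fin d → ℤ) : 0 < heatSymbol α t n :=
  Real.exp_pos _

theorem norm_mFourier_apply {d : ℕ} (n : Fin d → ℤ) (x : UnitAddTorus (Fin d)) :
    ‖UnitAddTorus.mFourier n x‖ = 1 := by
  change ‖∏ i, fourier (n i) (x i)‖ = 1
  rw [norm_prod]
  exact Finset.prod_eq_one fun i _ => Circle.norm_coe _

theorem norm_le_freqNorm {d : ℕ} (n : Fin d → ℤ) :
    ‖(fun i => (n i : ℝ) : Fin d → ℝ)‖ ≤ freqNorm n := by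
  refine (pi_norm_le_iff_of_nonneg (Real.sqrt_nonneg _)).2 fun i => ?_
  refine Real.le_sqrt_of_sq_le ?_
  rw [Real.norm_eq_abs, sq_abs]
  exact Finset.single_le_sum (f := fun i => (n i : ℝ) ^ 2) (fun j _ => sq_nonneg _)
    (Finset.mem_univ i)

theorem summable_heatSymbol {d : ℕ} {α t : ℝ} (hα : 0 < α) (ht : 0 < t) :
    Summable (heatSymbol α t : (Fin d → ℤ) → ℝ) := by
  let L : Submodule ℤ (Fin d → ℝ) := Submodule.span ℤ (Set.range (Pi.basisFun ℝ (Fin d)))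
  have hL : ∀ n : Fin d → ℤ, (fun i => (n i : ℝ)) ∈ L := fun n =>
    ((Pi.basisFun ℝ (Fin d)).mem_span_iff_repr_mem ℤ _).2 fun i => ⟨n i, by simp⟩
  obtain ⟨m, hm⟩ := exists_nat_gt ((Module.finrank ℤ L : ℝ) / α)
  have hr : -(α * m) < -(Module.finrank ℤ L : ℝ) := by
    rw [div_lt_iff₀ hα] at hm
    linarith
  have hs := ZLattice.summable_norm_rpow L _ hr
  have hinj : Function.Injective
      (fun n : Fin d → ℤ => (⟨fun i => (n i : ℝ), hL n⟩ : L)) := by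
    intro a b h
    funext i
    have h1 : ((a i : ℤ) : ℝ) = (b i : ℝ) := congrFun (congrArg Subtype.val h) i
    exact_mod_cast h1
  have hs2 := (hs.comp_injective hinj).mul_left ((m.factorial : ℝ) * (t ^ m)⁻¹)
  refine Summable.of_norm_bounded_eventually hs2 ?_
  refine (Set.finite_singleton (0 : Fin d → ℤ)).subset fun n hn => ?_
  by_contra h0
  refine hn ?_
  have hpos : 0 < ‖(fun i => (n i : ℝ) : Fin d → ℝ)‖ := by
    refine norm_pos_iff.2 fun h => h0 ?_
    funext i
    have := congrFun h i
    simpa using this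
  set z := ‖(fun i => (n i : ℝ) : Fin d → ℝ)‖ with hz
  have hz2 : z ≤ 2 * Real.pi * freqNorm n := by
    have h1 := norm_le_freqNorm n
    have h2 := Real.pi_gt_three
    nlinarith
  have hu : 0 < t * z ^ α := by positivity
  have h3 : heatSymbol α t n ≤ Real.exp (-(t * z ^ α)) := by
    unfold heatSymbol
    gcongr
  have h4 := Real.pow_div_factorial_le_exp (t * z ^ α) hu.le m
  have h5 : Real.exp (-(t * z ^ α)) ≤ ((t * z ^ α) ^ m / m.factorial)⁻¹ := by
    rw [Real.exp_neg]
    exact inv_anti₀ (by positivity) h4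
  have h6 : ((t * z ^ α) ^ m / m.factorial)⁻¹ =
      (m.factorial : ℝ) * (t ^ m)⁻¹ * z ^ (-(α * m)) := by
    rw [Real.rpow_neg hpos.le, Real.rpow_mul hpos.le, Real.rpow_natCast, mul_pow]
    field_simp
  have h7 : ‖heatSymbol α t n‖ = heatSymbol α t n := by
    rw [Real.norm_eq_abs, abs_of_pos (heatSymbol_pos α t n)]
  change ‖heatSymbol α t n‖ ≤ _
  rw [h7]
  exact (h3.trans h5).trans_eq h6

theorem norm_mFourierCoeff_le {d : ℕ} (f : UnitAddTorus (Fin d) → ℂ) (n : Fin d → ℤ) :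
    ‖UnitAddTorus.mFourierCoeff f n‖ ≤ ∫ x, ‖f x‖ ∂torusMeasure d := by
  refine (norm_integral_le_integral_norm _).trans (le_of_eq ?_)
  refine integral_congr_ae (Filter.Eventually.of_forall fun x => ?_)
  simp [norm_mFourier_apply]

/-- The terms of the series defining `fracHeat α t f` are absolutely summable. -/
theorem summable_norm_fracHeat {d : ℕ} {α t : ℝ} (hα : 0 < α) (ht : 0 < t)
    (f : UnitAddTorus (Fin d) → ℂ) :
    Summable fun n : Fin d → ℤ =>
      ‖((heatSymbol α t n : ℂ) * UnitAddTorus.mFourierCoeff f n) • UnitAddTorus.mFourier n‖ := by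
  refine ((summable_heatSymbol hα ht).mul_right (∫ x, ‖f x‖ ∂torusMeasure d)).of_nonneg_of_le
    (fun n => norm_nonneg _) fun n => ?_
  rw [norm_smul, UnitAddTorus.mFourier_norm, mul_one, norm_mul, Complex.norm_real,
    Real.norm_eq_abs, abs_of_pos (heatSymbol_pos α t n)]
  exact mul_le_mul_of_nonneg_left (norm_mFourierCoeff_le f n) (Real.exp_pos _).le

theorem integral_mFourier {d : ℕ} (n : Fin d → ℤ) :
    ∫ x, UnitAddTorus.mFourier n x ∂torusMeasure d = if n = 0 then 1 else 0 := by
  have h := orthonormal_iff_ite.mp (UnitAddTorus.orthonormal_mFourier (d := Fin d)) 0 n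
  simp only [ContinuousMap.inner_toLp, ← UnitAddTorus.mFourier_neg,
    ← UnitAddTorus.mFourier_add] at h
  simp only [neg_zero, add_zero, eq_comm (a := (0 : Fin d → ℤ))] at h
  exact h

/-- `fracHeat α t` acts on Fourier coefficients as multiplication by `e^{-t (2π|n|)^α}`. -/
theorem mFourierCoeff_fracHeat {d : ℕ} {α t : ℝ} (hα : 0 < α) (ht : 0 < t)
    (f : UnitAddTorus (Fin d) → ℂ) (m : Fin d → ℤ) :
    UnitAddTorus.mFourierCoeff (fracHeat α t f) m =
      (heatSymbol α t m : ℂ) * UnitAddTorus.mFourierCoeff f m := by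
  have : IsProbabilityMeasure (torusMeasure d) := by
    unfold torusMeasure; infer_instance
  have hs := summable_norm_fracHeat hα ht f
  set c : (Fin d → ℤ) → ℂ := fun n => (heatSymbol α t n : ℂ) * UnitAddTorus.mFourierCoeff f n
  have key : ∀ x, UnitAddTorus.mFourier (-m) x • fracHeat α t f x =
      ∑' n, c n * UnitAddTorus.mFourier (n + -m) x := by
    intro x
    rw [fracHeat, smul_eq_mul, ← tsum_mul_left]
    refine tsum_congr fun n => ?_
    rw [UnitAddTorus.mFourier_add]
    ring
  have hc : ∀ n k : Fin d → ℤ, ∀ x, ‖c n * UnitAddTorus.mFourier k x‖ = ‖c n‖ := by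
    intro n k x
    rw [norm_mul, norm_mFourier_apply, mul_one]
  have hcs : Summable fun n => ‖c n‖ := by
    refine hs.congr fun n => ?_
    rw [norm_smul, UnitAddTorus.mFourier_norm, mul_one]
  have h1 : UnitAddTorus.mFourierCoeff (fracHeat α t f) m =
      ∫ x, ∑' n, c n * UnitAddTorus.mFourier (n + -m) x ∂torusMeasure d :=
    integral_congr_ae (Filter.Eventually.of_forall key)
  rw [h1, ← integral_tsum_of_summable_integral_norm]
  · simp_rw [integral_const_mul, integral_mFourier]
    rw [tsum_eq_single m]
    · simp [c]
    · intro n hn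
      rw [if_neg (by simpa [← sub_eq_add_neg, sub_eq_zero] using hn), mul_zero]
  · intro n
    refine Integrable.const_mul ?_ _
    refine Integrable.of_bound (UnitAddTorus.mFourier (n + -m)).continuous.aestronglyMeasurable 1
      (Filter.Eventually.of_forall fun x => ?_)
    rw [norm_mFourier_apply]
  · simp only [hc]
    simpa using hcs

end PeriodicHeat

/-!
Both parts are bounds for Fourier multipliers on mean-zero trigonometric polynomials, which pass to
`Lᵠ` by density when `q < ∞` and to `L^∞` by letting `q → ∞`.

For part (1), `e^{lΔ}` is a contraction, being a limit of combinations of translations, and halves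
the `Lᵠ` norm for all large `l`, uniformly in `q`, because its symbol is summable with sum tending
to zero. Hence the resolvents `r (r - Δ)⁻¹` have norm at most `1 - e^{-r l₀} / 2`. Writing `|n|^α`
as an integral of resolvents, a fractional power being an average of `1 - r / (r + ·)`, turns this
gain into exponential decay. No such averaging is available at `α = 2`.

For part (2), the two-point inequality
`4 (q - 1) / q² ‖V a - V b‖² ≤ ⟪a - b, ‖a‖^{q-2} a - ‖b‖^{q-2} b⟫` for `V z = ‖z‖^{q/2-1} z` bounds
the dissipation of the `Lᵠ` norm below by the Dirichlet form of `V u`, through difference quotients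
and Parseval. The Poincaré inequality then controls the variance of `V u`, and a second two-point
inequality bounds `∫ ‖u‖^q` by twice this variance when `u` has mean zero. The resulting resolvent
bound gives the decay of the heat semigroup by the exponential formula.
-/

namespace PeriodicHeat

section Multiplier

open Filter Topology Set

variable {ι E : Type*} [NormedAddCommGroup E] [NormedSpace ℂ E]

/-- The multiplier `m` with respect to the system `e` has operator norm at most `κ` on the finite
linear combinations of the vectors `e n` with `n ∈ A`. Symbols are real, which is all that heat
semigroups need. -/
def MultiplierBound (e : ι → E) (A : Set ι) (κ : ℝ) (m : ι → ℝ) : Prop :=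
  ∀ S : Finset ι, ↑S ⊆ A → ∀ c : ι → ℂ,
    ‖∑ n ∈ S, m n • c n • e n‖ ≤ κ * ‖∑ n ∈ S, c n • e n‖

namespace MultiplierBound

variable {e : ι → E} {A : Set ι} {κ κ' : ℝ} {m m' ψ : ι → ℝ}

theorem mono (h : MultiplierBound e A κ m) (hκ : κ ≤ κ') : MultiplierBound e A κ' m :=
  fun S hS c => (h S hS c).trans (mul_le_mul_of_nonneg_right hκ (norm_nonneg _))

theorem one (e : ι → E) (A : Set ι) : MultiplierBound e A 1 1 := fun S _ c => by simp

theorem mul (hκ : 0 ≤ κ) (h : MultiplierBound e A κ m) (h' : MultiplierBound e A κ' m') :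
    MultiplierBound e A (κ * κ') (m * m') := fun S hS c => by
  have h₁ := h S hS fun n => m' n • c n
  simp only [smul_assoc] at h₁
  calc ‖∑ n ∈ S, (m * m') n • c n • e n‖ = ‖∑ n ∈ S, m n • m' n • c n • e n‖ := by
        simp only [Pi.mul_apply, mul_smul]
    _ ≤ κ * ‖∑ n ∈ S, m' n • c n • e n‖ := h₁
    _ ≤ κ * (κ' * ‖∑ n ∈ S, c n • e n‖) := mul_le_mul_of_nonneg_left (h' S hS c) hκ
    _ = κ * κ' * ‖∑ n ∈ S, c n • e n‖ := (mul_assoc _ _ _).symm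

theorem pow (hκ : 0 ≤ κ) (h : MultiplierBound e A κ m) (k : ℕ) :
    MultiplierBound e A (κ ^ k) (m ^ k) := by
  induction k with
  | zero => simpa only [pow_zero] using one e A
  | succ k ih => simpa only [pow_succ] using ih.mul (pow_nonneg hκ k) h

theorem add (h : MultiplierBound e A κ m) (h' : MultiplierBound e A κ' m') :
    MultiplierBound e A (κ + κ') (m + m') := fun S hS c => by
  simp only [Pi.add_apply, add_smul, Finset.sum_add_distrib, add_mul]
  exact (norm_add_le _ _).trans (add_le_add (h S hS c) (h' S hS c))

theorem const_smul {s : ℝ} (hs : 0 ≤ s) (h : MultiplierBound e A κ m) :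
    MultiplierBound e A (s * κ) (s • m) := fun S hS c => by
  simp only [Pi.smul_apply, smul_assoc, ← Finset.smul_sum, norm_smul, Real.norm_of_nonneg hs,
    mul_assoc]
  exact mul_le_mul_of_nonneg_left (h S hS c) hs

theorem finset_sum {J : Type*} (s : Finset J) {κ : J → ℝ} {m : J → ι → ℝ}
    (h : ∀ j ∈ s, MultiplierBound e A (κ j) (m j)) :
    MultiplierBound e A (∑ j ∈ s, κ j) (∑ j ∈ s, m j) := by
  classical
  induction s using Finset.induction_on with
  | empty => intro S _ c; simp
  | insert a s ha ih =>
    rw [Finset.sum_insert ha, Finset.sum_insert ha]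
    exact (h a (Finset.mem_insert_self a s)).add
      (ih fun j hj => h j (Finset.mem_insert_of_mem hj))

theorem of_tendsto {X : Type*} {l : Filter X} [l.NeBot] {K : X → ℝ} {M : X → ι → ℝ}
    (hK : Tendsto K l (𝓝 κ)) (hM : ∀ n, Tendsto (fun x => M x n) l (𝓝 (m n)))
    (h : ∀ᶠ x in l, MultiplierBound e A (K x) (M x)) : MultiplierBound e A κ m :=
  fun S hS c => le_of_tendsto_of_tendsto
    (tendsto_finsetSum S fun n _ => (hM n).smul_const _).norm (hK.mul_const _)
    (h.mono fun _ hx => hx S hS c)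

theorem integral [CompleteSpace E] {X : Type*} [MeasurableSpace X] {ν : Measure X} {K : X → ℝ}
    {M : X → ι → ℝ} (hK : Integrable K ν) (hM : ∀ n, Integrable (fun x => M x n) ν)
    (h : ∀ᵐ x ∂ν, MultiplierBound e A (K x) (M x)) :
    MultiplierBound e A (∫ x, K x ∂ν) (fun n => ∫ x, M x n ∂ν) := fun S hS c => by
  have hi : ∀ n ∈ S, Integrable (fun x => M x n • c n • e n) ν := fun n _ =>
    (hM n).smul_const _
  simp only [← integral_smul_const]
  rw [← integral_finsetSum S hi, ← integral_mul_const]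
  exact (norm_integral_le_integral_norm _).trans (integral_mono_ae
    (integrable_finsetSum S hi).norm (hK.mul_const _) (h.mono fun x hx => hx S hS c))

theorem exp_sub (hκ : 0 ≤ κ) (h : MultiplierBound e A κ m) {s : ℝ} (hs : 0 ≤ s) (a : ℝ) :
    MultiplierBound e A (Real.exp (s * (κ - a))) (fun n => Real.exp (s * (m n - a))) := by
  have hexp : MultiplierBound e A (Real.exp (s * κ)) (fun n => Real.exp (s * m n)) := by
    refine of_tendsto (l := atTop) (Real.tendsto_one_add_div_pow_exp (s * κ))
      (fun n => Real.tendsto_one_add_div_pow_exp (s * m n)) (Eventually.of_forall fun k => ?_)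
    have hk := ((one e A).add (h.const_smul (s := s / k) (by positivity))).pow (by positivity) k
    simpa only [Pi.pow_def, Pi.add_apply, Pi.one_apply, Pi.smul_apply, smul_eq_mul,
      div_mul_eq_mul_div] using hk
  have hscaled := hexp.const_smul (Real.exp_pos (-(s * a))).le
  have hsub (x : ℝ) : Real.exp (s * (x - a)) = Real.exp (-(s * a)) * Real.exp (s * x) := by
    rw [← Real.exp_add]
    ring_nf
  simpa only [hsub, Pi.smul_def, smul_eq_mul] using hscaled

/-- The exponential formula `e^{-tψ} = lim (1 + tψ/k)^{-k}`. -/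
theorem exp_neg_of_resolvent {t : ℝ} (hκ : 0 ≤ κ) (hψ : ∀ n, 0 ≤ ψ n) (ht : 0 < t)
    (h : ∀ r, 0 < r → MultiplierBound e A (r / (r + κ)) (fun n => r / (r + ψ n))) :
    MultiplierBound e A (Real.exp (-(t * κ))) (fun n => Real.exp (-(t * ψ n))) := by
  have hlim (x : ℝ) (hx : 0 ≤ x) :
      Tendsto (fun k : ℕ => (k / t / (k / t + x)) ^ k) atTop (𝓝 (Real.exp (-(t * x)))) := by
    have hinv := (Real.tendsto_one_add_div_pow_exp (t * x)).inv₀ (Real.exp_ne_zero _)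
    rw [← Real.exp_neg] at hinv
    refine hinv.congr' ?_
    filter_upwards [eventually_gt_atTop 0] with k hk
    have : (0 : ℝ) < k := Nat.cast_pos.2 hk
    rw [← inv_pow]
    congr 1
    field_simp
  refine of_tendsto (l := atTop) (hlim κ hκ) (fun n => hlim (ψ n) (hψ n)) ?_
  filter_upwards [eventually_gt_atTop 0] with k hk
  have : (0 : ℝ) < k := Nat.cast_pos.2 hk
  exact (h (k / t) (by positivity)).pow (by positivity) k

theorem of_summable [DecidableEq ι] {φ : ι → E →L[ℂ] ℂ} (he : ∀ n, ‖e n‖ ≤ 1) (hφ : ∀ n, ‖φ n‖ ≤ 1)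
    (hφe : ∀ i j, φ i (e j) = if i = j then 1 else 0)
    (hm : Summable (A.indicator fun n => |m n|)) :
    MultiplierBound e A (∑' n, A.indicator (fun n => |m n|) n) m := fun S hS c => by
  set x := ∑ n ∈ S, c n • e n with hx
  have hcoeff (n : ι) (hn : n ∈ S) : ‖c n‖ ≤ ‖x‖ := by
    have hcn : φ n x = c n := by simp [hx, hφe, hn]
    calc ‖c n‖ = ‖φ n x‖ := by rw [hcn]
      _ ≤ 1 * ‖x‖ := (φ n).le_of_opNorm_le (hφ n) x
      _ = ‖x‖ := one_mul _
  calc ‖∑ n ∈ S, m n • c n • e n‖ ≤ ∑ n ∈ S, |m n| * ‖x‖ := by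
        refine norm_sum_le_of_le S fun n hn => ?_
        rw [norm_smul, norm_smul, Real.norm_eq_abs]
        gcongr
        exact (mul_le_of_le_one_right (norm_nonneg _) (he n)).trans (hcoeff n hn)
    _ = (∑ n ∈ S, A.indicator (fun n => |m n|) n) * ‖x‖ := by
        rw [Finset.sum_mul]
        exact Finset.sum_congr rfl fun n hn => by rw [indicator_of_mem (hS hn)]
    _ ≤ (∑' n, A.indicator (fun n => |m n|) n) * ‖x‖ := by
        gcongr
        exact hm.sum_le_tsum S fun n _ => indicator_nonneg (fun _ _ => abs_nonneg _) n

theorem norm_map_le (h : MultiplierBound e A κ m) {T : E →L[ℂ] E}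
    (hT : ∀ n ∈ A, T (e n) = m n • e n) {g : E}
    (hg : g ∈ closure (Submodule.span ℂ (e '' A) : Set E)) : ‖T g‖ ≤ κ * ‖g‖ := by
  refine closure_minimal ?_ (isClosed_le T.continuous.norm (continuous_norm.const_mul κ)) hg
  intro g hg
  obtain ⟨c, hc, rfl⟩ := (Finsupp.mem_span_image_iff_linearCombination ℂ).1 hg
  have hsum := h c.support hc c
  have hTsum : T (∑ n ∈ c.support, c n • e n) = ∑ n ∈ c.support, m n • c n • e n := by
    rw [map_sum]
    refine Finset.sum_congr rfl fun n hn => ?_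
    rw [map_smul, hT n (hc hn), smul_comm]
  rwa [← hTsum] at hsum

end MultiplierBound

theorem mem_closure_span_image_compl [DecidableEq ι] {e : ι → E}
    (he : Dense (Submodule.span ℂ (range e) : Set E)) {φ : E →L[ℂ] ℂ} {i : ι}
    (hφ : ∀ j, φ (e j) = if i = j then 1 else 0) {g : E} (hg : φ g = 0) :
    g ∈ closure (Submodule.span ℂ (e '' {i}ᶜ) : Set E) := by
  let P : E →L[ℂ] E := .id ℂ E - φ.smulRight (e i)
  have hP : Submodule.span ℂ (range e) ≤
      (Submodule.span ℂ (e '' {i}ᶜ)).comap (P : E →ₗ[ℂ] E) := by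
    refine Submodule.span_le.2 ?_
    rintro _ ⟨j, rfl⟩
    have hPj : P (e j) = e j - (if i = j then 1 else 0 : ℂ) • e i := by simp [P, hφ]
    change P (e j) ∈ Submodule.span ℂ (e '' {i}ᶜ)
    rcases eq_or_ne j i with rfl | hj
    · simp [hPj]
    · simpa [hPj, hj.symm] using Submodule.subset_span (mem_image_of_mem e hj)
  have hgP : P g = g := by simp [P, hg]
  rw [← hgP]
  exact map_mem_closure P.continuous (he g) fun x hx => hP hx

end Multiplier

section Subordination

open Filter Topology Set

variable {ι E : Type*} [NormedAddCommGroup E] [NormedSpace ℂ E] [CompleteSpace E]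
  {e : ι → E} {A : Set ι} {ψ : ι → ℝ}

namespace MultiplierBound

/-- The resolvent is the Laplace transform of the semigroup, so that a gain at large times survives
in the resolvent. -/
theorem resolvent_of_exp_neg {r l₀ : ℝ} (hψ : ∀ n, 0 ≤ ψ n) (hr : 0 < r) (hl₀ : 0 ≤ l₀)
    (hone : ∀ l, 0 < l → MultiplierBound e A 1 (fun n => Real.exp (-(l * ψ n))))
    (hhalf : ∀ l, l₀ < l → MultiplierBound e A (1 / 2) (fun n => Real.exp (-(l * ψ n)))) :
    MultiplierBound e A (1 - Real.exp (-(r * l₀)) / 2) (fun n => r / (r + ψ n)) := by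
  have hexp (s x : ℝ) (hs : 0 < s) : IntegrableOn (fun l => Real.exp (-s * l)) (Ioi x) :=
    integrableOn_exp_mul_Ioi (neg_neg_of_pos hs) x
  have hint (s x : ℝ) (hs : 0 < s) :
      ∫ l in Ioi x, r * Real.exp (-s * l) = r * Real.exp (-(s * x)) / s := by
    rw [integral_const_mul, integral_exp_mul_Ioi (neg_neg_of_pos hs), neg_mul, neg_div_neg_eq,
      mul_div_assoc]
  let K : ℝ → ℝ := (fun l => r * Real.exp (-r * l)) -
    (Ioi l₀).indicator fun l => r * Real.exp (-r * l) / 2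
  have hK₁ : IntegrableOn (fun l => r * Real.exp (-r * l)) (Ioi 0) := (hexp r 0 hr).const_mul r
  have hK₂ : IntegrableOn ((Ioi l₀).indicator fun l => r * Real.exp (-r * l) / 2) (Ioi 0) :=
    (hK₁.div_const 2).indicator measurableSet_Ioi
  have hKint : ∫ l in Ioi 0, K l = 1 - Real.exp (-(r * l₀)) / 2 := by
    rw [integral_sub' hK₁ hK₂, setIntegral_indicator measurableSet_Ioi, Ioi_inter_Ioi,
      sup_of_le_right hl₀, integral_div, hint r 0 hr, hint r l₀ hr]
    field_simp
    simp
  have hMint (n : ι) : ∫ l in Ioi 0, r * Real.exp (-(r + ψ n) * l) = r / (r + ψ n) := by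
    rw [hint (r + ψ n) 0 (add_pos_of_pos_of_nonneg hr (hψ n)), mul_zero, neg_zero, Real.exp_zero,
      mul_one]
  rw [← hKint, ← funext hMint]
  refine integral (hK₁.sub hK₂)
    (fun n => (hexp _ 0 (add_pos_of_pos_of_nonneg hr (hψ n))).const_mul r) ?_
  filter_upwards [ae_restrict_mem measurableSet_Ioi] with l hl
  have hscale {κ : ℝ} (h : MultiplierBound e A κ (fun n => Real.exp (-(l * ψ n)))) :
      MultiplierBound e A (r * Real.exp (-r * l) * κ)
        (fun n => r * Real.exp (-(r + ψ n) * l)) := by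
    have hsplit (n : ι) : r * Real.exp (-(r + ψ n) * l) =
        r * Real.exp (-r * l) * Real.exp (-(l * ψ n)) := by
      rw [mul_assoc, ← Real.exp_add]
      ring_nf
    simp only [hsplit]
    exact h.const_smul (by positivity)
  by_cases hl' : l ∈ Ioi l₀
  · refine (hscale (hhalf l hl')).mono (le_of_eq ?_)
    simp only [K, Pi.sub_apply, indicator_of_mem hl']
    ring
  · refine (hscale (hone l hl)).mono (le_of_eq ?_)
    simp [K, indicator_of_notMem hl']

end MultiplierBound

/-- The decay rate of `e^{-tψ^β}` that results from a bound `1 - ρ r` of the resolvents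
`r / (r + ψ)`. -/
noncomputable def subordinateRate (β : ℝ) (ρ : ℝ → ℝ) : ℝ :=
  (∫ r in Ioi 0, r ^ (β - 1) * ρ r) / ∫ r in Ioi 0, Real.rpowIntegrand₀₁ β r 1

theorem subordinateRate_exp_pos {β l : ℝ} (hβ : β ∈ Ioo 0 1) (hl : 0 < l) :
    0 < subordinateRate β fun r => Real.exp (-(r * l)) / 2 := by
  refine div_pos ?_ (Real.integral_rpowIntegrand₀₁_one_pos hβ)
  have h : ∫ r in Ioi 0, r ^ (β - 1) * (Real.exp (-(r * l)) / 2) =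
      (1 / l) ^ β * Real.Gamma β / 2 := by
    simp only [← mul_div_assoc]
    rw [integral_div, ← Real.integral_rpow_mul_exp_neg_mul_Ioi hβ.1 hl]
    simp only [mul_comm l]
  rw [h]
  have := Real.Gamma_pos_of_pos hβ.1
  positivity

theorem rpowIntegrand₀₁_eq_sub {β r x : ℝ} (hr : 0 < r) (hx : 0 ≤ x) :
    Real.rpowIntegrand₀₁ β r x = r ^ (β - 1) - r ^ (β - 1) * (r / (r + x)) := by
  have : 0 < r + x := by positivity
  rw [Real.rpowIntegrand₀₁, Real.rpow_sub_one hr.ne']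
  field_simp

namespace MultiplierBound

variable {β : ℝ} {ρ : ℝ → ℝ}

theorem exp_neg_integral_rpowIntegrand₀₁ {s : ℝ} (hβ : β ∈ Ioo 0 1) (hs : 0 ≤ s)
    (hψ : ∀ n, 0 ≤ ψ n) (hρ : IntegrableOn (fun r => r ^ (β - 1) * ρ r) (Ioi 0))
    (hρ₁ : ∀ r, 0 < r → ρ r ≤ 1)
    (h : ∀ r, 0 < r → MultiplierBound e A (1 - ρ r) (fun n => r / (r + ψ n))) {R : ℝ}
    (hR : 0 ≤ R) :
    MultiplierBound e A (Real.exp (-(s * ∫ r in 0..R, r ^ (β - 1) * ρ r)))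
      (fun n => Real.exp (-(s * ∫ r in 0..R, Real.rpowIntegrand₀₁ β r (ψ n)))) := by
  simp only [intervalIntegral.integral_of_le hR]
  have hw : IntegrableOn (fun r : ℝ => r ^ (β - 1)) (Ioc 0 R) :=
    (intervalIntegrable_iff_integrableOn_Ioc_of_le hR).1
      (intervalIntegral.intervalIntegrable_rpow' (by linarith [hβ.1]))
  have hwρ : IntegrableOn (fun r => r ^ (β - 1) * ρ r) (Ioc 0 R) :=
    hρ.mono_set Ioc_subset_Ioi_self
  have hwψ (n : ι) : IntegrableOn (fun r => Real.rpowIntegrand₀₁ β r (ψ n)) (Ioc 0 R) :=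
    (Real.integrableOn_rpowIntegrand₀₁_Ioi hβ (hψ n)).mono_set Ioc_subset_Ioi_self
  have hMB := integral (hw.sub hwρ) (fun n => hw.sub (hwψ n)) <| by
    filter_upwards [ae_restrict_mem measurableSet_Ioc] with r hr
    have hr₀ : 0 < r := hr.1
    have hscaled := (h r hr₀).const_smul (Real.rpow_nonneg hr₀.le (β - 1))
    simpa only [Pi.sub_apply, rpowIntegrand₀₁_eq_sub hr₀ (hψ _), sub_sub_cancel, mul_sub, mul_one,
      Pi.smul_def, smul_eq_mul] using hscaled
  have hκ : 0 ≤ ∫ r in Ioc 0 R, (r ^ (β - 1) - r ^ (β - 1) * ρ r) := by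
    refine setIntegral_nonneg measurableSet_Ioc fun r hr => sub_nonneg.2 ?_
    exact mul_le_of_le_one_right (Real.rpow_nonneg hr.1.le _) (hρ₁ r hr.1)
  have hexp := hMB.exp_sub hκ hs (∫ r in Ioc 0 R, r ^ (β - 1))
  simpa only [integral_sub hw hwρ, integral_sub' hw (hwψ _), sub_sub_cancel_left, mul_neg]
    using hexp

/-- Balakrishnan's formula writes `ψ^β` as an average of `1 - r / (r + ψ)`. The weights
`r ^ (β - 1)` are not integrable at infinity, hence the truncated version above. -/
theorem exp_neg_rpow {t : ℝ} (hβ : β ∈ Ioo 0 1) (ht : 0 ≤ t)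
    (hψ : ∀ n, 0 ≤ ψ n) (hρ : IntegrableOn (fun r => r ^ (β - 1) * ρ r) (Ioi 0))
    (hρ₁ : ∀ r, 0 < r → ρ r ≤ 1)
    (h : ∀ r, 0 < r → MultiplierBound e A (1 - ρ r) (fun n => r / (r + ψ n))) :
    MultiplierBound e A (Real.exp (-(t * subordinateRate β ρ)))
      (fun n => Real.exp (-(t * ψ n ^ β))) := by
  set C := ∫ r in Ioi 0, Real.rpowIntegrand₀₁ β r 1 with hC
  have hC₀ : 0 < C := Real.integral_rpowIntegrand₀₁_one_pos hβ
  have hlim {g : ℝ → ℝ} {y : ℝ} (hg : IntegrableOn g (Ioi 0)) (hy : ∫ r in Ioi 0, g r = C * y) :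
      Tendsto (fun R => Real.exp (-(t / C * ∫ r in 0..R, g r))) atTop
        (𝓝 (Real.exp (-(t * y)))) := by
    have hty : t * y = t / C * ∫ r in Ioi 0, g r := by rw [hy]; field_simp
    rw [hty]
    exact ((intervalIntegral_tendsto_integral_Ioi 0 hg tendsto_id).const_mul _).neg.rexp
  refine of_tendsto (l := atTop) (hlim hρ ?_)
    (fun n => hlim (Real.integrableOn_rpowIntegrand₀₁_Ioi hβ (hψ n)) ?_) ?_
  · rw [subordinateRate, ← hC, mul_div_cancel₀ _ hC₀.ne']
  · rw [Real.integral_rpowIntegrand₀₁_eq_rpow_mul_const hβ (hψ n), mul_comm]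
  · filter_upwards [eventually_ge_atTop 0] with R hR
    exact exp_neg_integral_rpowIntegrand₀₁ hβ (by positivity) hψ hρ hρ₁ h hR

theorem exp_neg_rpow_of_half {l₀ t : ℝ} (hβ : β ∈ Ioo 0 1) (hl₀ : 0 < l₀) (ht : 0 ≤ t)
    (hψ : ∀ n, 0 ≤ ψ n)
    (hone : ∀ l, 0 < l → MultiplierBound e A 1 (fun n => Real.exp (-(l * ψ n))))
    (hhalf : ∀ l, l₀ < l → MultiplierBound e A (1 / 2) (fun n => Real.exp (-(l * ψ n)))) :
    MultiplierBound e A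
      (Real.exp (-(t * subordinateRate β fun r => Real.exp (-(r * l₀)) / 2)))
      (fun n => Real.exp (-(t * ψ n ^ β))) := by
  refine exp_neg_rpow hβ ht hψ ?_ (fun r hr => ?_)
    fun r hr => resolvent_of_exp_neg hψ hr hl₀.le hone hhalf
  · have hint := (integrableOn_rpow_mul_exp_neg_mul_rpow (s := β - 1) (by linarith [hβ.1])
      one_pos hl₀).div_const 2
    simpa only [Real.rpow_one, neg_mul, mul_comm l₀, mul_div_assoc, IntegrableOn] using hint
  · have := Real.exp_le_one_iff.2 (neg_nonpos.2 (mul_pos hr hl₀).le)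
    linarith

end MultiplierBound

end Subordination

section TwoPoint

open Set

theorem sq_sub_le_mul_sub_of_deriv_sq {A B C f g : ℝ → ℝ} {x y : ℝ} (hxy : x ≤ y)
    (hA : ContinuousOn A (Icc x y)) (hB : ContinuousOn B (Icc x y)) (hC : ContinuousOn C (Icc x y))
    (hA' : ∀ s ∈ Ioo x y, HasDerivAt A (f s ^ 2) s)
    (hB' : ∀ s ∈ Ioo x y, HasDerivAt B (f s * g s) s)
    (hC' : ∀ s ∈ Ioo x y, HasDerivAt C (g s ^ 2) s) :
    (B y - B x) ^ 2 ≤ (A y - A x) * (C y - C x) := by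
  have hquad (T : ℝ) :
      0 ≤ (A y - A x) * (T * T) + 2 * (B y - B x) * T + (C y - C x) := by
    let Q : ℝ → ℝ := fun s => A s * (T * T) + 2 * B s * T + C s
    have hQ' : ∀ s ∈ Ioo x y, HasDerivAt Q ((f s * T + g s) ^ 2) s := fun s hs =>
      ((((hA' s hs).mul_const (T * T)).add (((hB' s hs).const_mul 2).mul_const T)).add
        (hC' s hs)).congr_deriv (by ring)
    have hQ : MonotoneOn Q (Icc x y) := by
      refine monotoneOn_of_hasDerivWithinAt_nonneg (convex_Icc x y)
        (((hA.mul_const _).add ((hB.const_mul 2).mul_const T)).add hC)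
        (fun s hs => (hQ' s ?_).hasDerivWithinAt) (fun s _ => sq_nonneg _)
      rwa [interior_Icc] at hs
    have hle : Q x ≤ Q y := hQ (left_mem_Icc.2 hxy) (right_mem_Icc.2 hxy) hxy
    linear_combination hle
  have hdiscr := discrim_le_zero hquad
  rw [discrim] at hdiscr
  linarith

theorem rpow_half_sub_sq_le {q x y : ℝ} (hq : 1 < q) (hx : 0 ≤ x) (hy : 0 ≤ y) :
    4 * (q - 1) / q ^ 2 * (x ^ (q / 2) - y ^ (q / 2)) ^ 2 ≤
      (x - y) * (x ^ (q - 1) - y ^ (q - 1)) := by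
  wlog hxy : x ≤ y generalizing x y
  · linarith [this hy hx (le_of_not_ge hxy)]
  have hq₁ : 0 < q - 1 := sub_pos.2 hq
  have hcs := sq_sub_le_mul_sub_of_deriv_sq (A := fun s => s ^ (q - 1) / (q - 1))
    (B := fun s => 2 / q * s ^ (q / 2)) (C := id) (f := fun s => s ^ (q / 2 - 1)) (g := 1) hxy
    ((continuousOn_id.rpow_const fun _ _ => Or.inr hq₁.le).div_const _)
    ((continuousOn_id.rpow_const fun _ _ => Or.inr (by linarith)).const_mul _) continuousOn_id
    (fun s hs => ?_) (fun s hs => ?_) (fun s _ => by simpa using hasDerivAt_id s)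
  · have : 0 < q := by linarith
    simp only [id, ← sub_div, ← mul_sub, div_mul_eq_mul_div, le_div_iff₀ hq₁] at hcs
    calc 4 * (q - 1) / q ^ 2 * (x ^ (q / 2) - y ^ (q / 2)) ^ 2 =
          (2 * (y ^ (q / 2) - x ^ (q / 2)) / q) ^ 2 * (q - 1) := by ring
      _ ≤ (y ^ (q - 1) - x ^ (q - 1)) * (y - x) := hcs
      _ = (x - y) * (x ^ (q - 1) - y ^ (q - 1)) := by ring
  · have hs₀ : 0 < s := hx.trans_lt hs.1
    refine ((Real.hasDerivAt_rpow_const (Or.inl hs₀.ne')).div_const (q - 1)).congr_deriv ?_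
    rw [mul_div_cancel_left₀ _ hq₁.ne', ← Real.rpow_mul_natCast hs₀.le]
    congr 1
    push_cast
    ring
  · have hs₀ : 0 < s := hx.trans_lt hs.1
    refine ((Real.hasDerivAt_rpow_const (Or.inl hs₀.ne')).const_mul (2 / q)).congr_deriv ?_
    simp only [Pi.one_apply]
    field_simp

variable {H : Type*} [NormedAddCommGroup H] [InnerProductSpace ℝ H]

/-- For fixed lengths of `a` and `b` the difference of the two sides is affine and decreasing in
the inner product of `a` and `b`, hence smallest for parallel vectors. -/
theorem norm_smul_sub_smul_sq_le_inner {k p r : ℝ} {a b : H} (hk : k ≤ 1) (hp : 0 ≤ p)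
    (hr : 0 ≤ r)
    (h : k * (p * ‖a‖ - r * ‖b‖) ^ 2 ≤ (‖a‖ - ‖b‖) * (p ^ 2 * ‖a‖ - r ^ 2 * ‖b‖)) :
    k * ‖p • a - r • b‖ ^ 2 ≤ inner ℝ (a - b) (p ^ 2 • a - r ^ 2 • b) := by
  have hpr : 0 ≤ p * r := mul_nonneg hp hr
  simp only [norm_sub_sq_real, norm_smul, Real.norm_of_nonneg hp, Real.norm_of_nonneg hr,
    inner_sub_left, inner_sub_right, real_inner_smul_left, real_inner_smul_right,
    real_inner_self_eq_norm_sq, real_inner_comm a b]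
  have hcoeff : 0 ≤ p ^ 2 + r ^ 2 - 2 * k * (p * r) := by nlinarith [sq_nonneg (p - r)]
  nlinarith [mul_nonneg hcoeff (sub_nonneg.2 (real_inner_le_norm a b))]

theorem inner_le_two_mul_norm_smul_sub_smul_sq {p r : ℝ} {a b : H} (hp : 0 ≤ p) (hr : 0 ≤ r)
    (h : 0 ≤ (‖a‖ - ‖b‖) * (p ^ 2 * ‖a‖ - r ^ 2 * ‖b‖)) :
    inner ℝ (a - b) (p ^ 2 • a - r ^ 2 • b) ≤ 2 * ‖p • a - r • b‖ ^ 2 := by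
  have hpr : 0 ≤ p * r * (‖a‖ * ‖b‖) := by positivity
  have hab : 0 ≤ (p - r) ^ 2 * (‖a‖ * ‖b‖) := by positivity
  have hinner : (4 * (p * r) - p ^ 2 - r ^ 2) * inner ℝ a b ≤
      p ^ 2 * ‖a‖ ^ 2 + r ^ 2 * ‖b‖ ^ 2 := by
    obtain ⟨hl, hu⟩ := abs_le.1 (abs_real_inner_le_norm a b)
    rcases le_total 0 (4 * (p * r) - p ^ 2 - r ^ 2) with h₀ | h₀
    · nlinarith [sq_nonneg (p * ‖a‖ - r * ‖b‖), mul_le_mul_of_nonneg_left hu h₀]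
    · nlinarith [mul_le_mul_of_nonpos_left hl h₀]
  simp only [norm_sub_sq_real, norm_smul, Real.norm_of_nonneg hp, Real.norm_of_nonneg hr,
    inner_sub_left, inner_sub_right, real_inner_smul_left, real_inner_smul_right,
    real_inner_self_eq_norm_sq, real_inner_comm a b]
  linarith

/-- The map `z ↦ ‖z‖ ^ (p - 1) z`, which raises lengths to the power `p`. For `p = q - 1` it is the
pointwise duality map of `Lᵠ`. -/
noncomputable def radialPow (p : ℝ) (z : H) : H := ‖z‖ ^ (p - 1) • z

theorem norm_radialPow {p : ℝ} (hp : 0 < p) (z : H) : ‖radialPow p z‖ = ‖z‖ ^ p := by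
  rw [radialPow, norm_smul, Real.norm_of_nonneg (by positivity),
    ← Real.rpow_add_one' (norm_nonneg z) (by simpa using hp.ne'), sub_add_cancel]

theorem continuous_radialPow {p : ℝ} (hp : 0 < p) : Continuous (radialPow p : H → H) := by
  refine continuous_iff_continuousAt.2 fun z => ?_
  rcases eq_or_ne z 0 with rfl | hz
  · have hlim : Filter.Tendsto (fun z : H => ‖z‖ ^ p) (nhds 0) (nhds 0) := by
      simpa [hp.ne'] using (continuous_norm.rpow_const fun _ : H => Or.inr hp.le).tendsto 0
    rw [ContinuousAt, radialPow, smul_zero, tendsto_zero_iff_norm_tendsto_zero]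
    simpa only [norm_radialPow hp] using hlim
  · exact (continuous_norm.continuousAt.rpow_const (Or.inl (norm_ne_zero_iff.2 hz))).smul
      continuousAt_id

theorem norm_radialPow_half_sq {q : ℝ} (hq : 0 < q) (z : H) :
    ‖radialPow (q / 2) z‖ ^ 2 = ‖z‖ ^ q := by
  rw [norm_radialPow (half_pos hq), ← Real.rpow_mul_natCast (norm_nonneg z), Nat.cast_two,
    div_mul_cancel₀ q two_ne_zero]

theorem radialPow_sub_one (q : ℝ) (z : H) :
    radialPow (q - 1) z = (‖z‖ ^ (q / 2 - 1)) ^ 2 • z := by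
  rw [radialPow, ← Real.rpow_mul_natCast (norm_nonneg z)]
  congr 2
  push_cast
  ring

theorem inner_radialPow_sub_one {q : ℝ} (hq : 0 < q) (z : H) :
    inner ℝ z (radialPow (q - 1) z) = ‖z‖ ^ q := by
  rw [← norm_radialPow_half_sq hq, radialPow_sub_one, real_inner_smul_right,
    real_inner_self_eq_norm_sq, radialPow, norm_smul, mul_pow, Real.norm_of_nonneg (by positivity)]

theorem mul_norm_sub_sq_le_radial {q : ℝ} (hq : 1 < q) (a b : H) :
    4 * (q - 1) / q ^ 2 *
        (‖a‖ ^ (q / 2 - 1) * ‖a‖ - ‖b‖ ^ (q / 2 - 1) * ‖b‖) ^ 2 ≤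
      (‖a‖ - ‖b‖) * ((‖a‖ ^ (q / 2 - 1)) ^ 2 * ‖a‖ - (‖b‖ ^ (q / 2 - 1)) ^ 2 * ‖b‖) := by
  have hhalf (z : H) : ‖z‖ ^ (q / 2 - 1) * ‖z‖ = ‖z‖ ^ (q / 2) := by
    rw [← Real.rpow_add_one' (norm_nonneg z) (by linarith), sub_add_cancel]
  have hone (z : H) : (‖z‖ ^ (q / 2 - 1)) ^ 2 * ‖z‖ = ‖z‖ ^ (q - 1) := by
    rw [← norm_radialPow (sub_pos.2 hq), radialPow_sub_one, norm_smul,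
      Real.norm_of_nonneg (by positivity)]
  simpa only [hhalf, hone] using rpow_half_sub_sq_le hq (norm_nonneg a) (norm_nonneg b)

/-- The Stroock–Varopoulos inequality. -/
theorem norm_radialPow_half_sub_sq_le_inner {q : ℝ} (hq : 1 < q) (a b : H) :
    4 * (q - 1) / q ^ 2 * ‖radialPow (q / 2) a - radialPow (q / 2) b‖ ^ 2 ≤
      inner ℝ (a - b) (radialPow (q - 1) a - radialPow (q - 1) b) := by
  have hk : 4 * (q - 1) / q ^ 2 ≤ 1 := by
    rw [div_le_one (by positivity)]
    nlinarith [sq_nonneg (q - 2)]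
  rw [radialPow_sub_one, radialPow_sub_one]
  exact norm_smul_sub_smul_sq_le_inner hk (by positivity) (by positivity)
    (mul_norm_sub_sq_le_radial hq a b)

theorem inner_le_two_mul_norm_radialPow_half_sub_sq {q : ℝ} (hq : 1 < q) (a b : H) :
    inner ℝ (a - b) (radialPow (q - 1) a - radialPow (q - 1) b) ≤
      2 * ‖radialPow (q / 2) a - radialPow (q / 2) b‖ ^ 2 := by
  have : 0 < q - 1 := sub_pos.2 hq
  rw [radialPow_sub_one, radialPow_sub_one]
  exact inner_le_two_mul_norm_smul_sub_smul_sq (by positivity) (by positivity)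
    (le_trans (by positivity) (mul_norm_sub_sq_le_radial hq a b))

end TwoPoint

section RadialPowLp

variable {X H : Type*} [MeasurableSpace X] {μ : Measure X} [NormedAddCommGroup H]
  [InnerProductSpace ℝ H]

theorem memLp_radialPow {p : ℝ} (hp : 0 < p) {q : ℝ≥0∞} {u : X → H} (hu : MemLp u q μ) :
    MemLp (fun x => radialPow p (u x)) (q / ENNReal.ofReal p) μ := by
  have hnorm := hu.norm_rpow_div (ENNReal.ofReal p)
  rw [ENNReal.toReal_ofReal hp.le] at hnorm
  refine hnorm.congr_norm ((continuous_radialPow hp).comp_aestronglyMeasurable hu.1)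
    (Filter.Eventually.of_forall fun x => ?_)
  rw [norm_radialPow hp, Real.norm_of_nonneg (by positivity)]

theorem integrable_radialPow [IsFiniteMeasure μ] {p q : ℝ} (hp : 0 < p) (hpq : p ≤ q) {u : X → H}
    (hu : MemLp u (ENNReal.ofReal q) μ) : Integrable (fun x => radialPow p (u x)) μ := by
  refine (memLp_radialPow hp hu).integrable ?_
  rw [← ENNReal.ofReal_div_of_pos hp, ENNReal.one_le_ofReal, one_le_div hp]
  exact hpq

/-- Hölder's inequality against the duality map. -/
theorem mul_rpow_integral_norm_rpow_le {q K : ℝ} (hq : 1 < q) {f u : X → H}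
    (hf : MemLp f (ENNReal.ofReal q) μ) (hu : MemLp u (ENNReal.ofReal q) μ)
    (h : K * ∫ x, ‖u x‖ ^ q ∂μ ≤ ∫ x, inner ℝ (f x) (radialPow (q - 1) (u x)) ∂μ) :
    K * (∫ x, ‖u x‖ ^ q ∂μ) ^ (1 / q) ≤ (∫ x, ‖f x‖ ^ q ∂μ) ^ (1 / q) := by
  have hq₁ : 0 < q - 1 := sub_pos.2 hq
  have hconj : q.HolderConjugate (q / (q - 1)) := Real.HolderConjugate.conjExponent hq
  set N := ∫ x, ‖u x‖ ^ q ∂μ with hN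
  have hN₀ : 0 ≤ N := integral_nonneg fun x => by positivity
  have hJ : MemLp (fun x => radialPow (q - 1) (u x)) (ENNReal.ofReal (q / (q - 1))) μ := by
    simpa only [ENNReal.ofReal_div_of_pos hq₁] using memLp_radialPow hq₁ hu
  have hJnorm (x : X) : ‖radialPow (q - 1) (u x)‖ ^ (q / (q - 1)) = ‖u x‖ ^ q := by
    rw [norm_radialPow hq₁, ← Real.rpow_mul (norm_nonneg _), mul_div_cancel₀ q hq₁.ne']
  have hHolder : K * N ≤ (∫ x, ‖f x‖ ^ q ∂μ) ^ (1 / q) * N ^ (1 / (q / (q - 1))) := by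
    have hint : Integrable (fun x => ‖f x‖ * ‖radialPow (q - 1) (u x)‖) μ :=
      have := hconj.ennrealOfReal
      hf.norm.integrable_mul hJ.norm
    calc K * N ≤ ∫ x, inner ℝ (f x) (radialPow (q - 1) (u x)) ∂μ := h
      _ ≤ ∫ x, ‖f x‖ * ‖radialPow (q - 1) (u x)‖ ∂μ :=
        (Real.le_norm_self _).trans (norm_integral_le_of_norm_le hint
          (Filter.Eventually.of_forall fun x => norm_inner_le_norm _ _))
      _ ≤ _ := integral_mul_norm_le_Lp_mul_Lq hconj hf hJ
      _ = _ := by simp only [hJnorm, ← hN]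
  rcases hN₀.eq_or_lt with hN₁ | hN₁
  · rw [← hN₁, Real.zero_rpow (by positivity), mul_zero]
    positivity
  · refine le_of_mul_le_mul_right ?_ (Real.rpow_pos_of_pos hN₁ (1 / (q / (q - 1))))
    rwa [mul_assoc, ← Real.rpow_add hN₁, hconj.one_div_add_one_div, div_one,
      Real.rpow_one]

theorem inner_sub_sub_eq (a b c e : H) :
    inner ℝ (a - c) (b - e) = inner ℝ a b - inner ℝ a e - inner ℝ b c + inner ℝ c e := by
  rw [inner_sub_left, inner_sub_right, inner_sub_right, real_inner_comm b c]
  ring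

theorem integrable_inner_sub_sub [IsFiniteMeasure μ] {F G : X → H}
    (hF : Integrable F μ) (hG : Integrable G μ)
    (hFG : Integrable (fun x => inner ℝ (F x) (G x)) μ) (a b : H) :
    Integrable (fun y => inner ℝ (a - F y) (b - G y)) μ := by
  simp only [inner_sub_sub_eq]
  exact (((integrable_const _).sub (hG.const_inner a)).sub (hF.const_inner b)).add hFG

variable [IsProbabilityMeasure μ]

theorem integral_inner_sub_sub [CompleteSpace H] {F G : X → H} (hF : Integrable F μ)
    (hG : Integrable G μ) (hFG : Integrable (fun x => inner ℝ (F x) (G x)) μ) (a b : H) :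
    ∫ y, inner ℝ (a - F y) (b - G y) ∂μ =
      inner ℝ a b - inner ℝ a (∫ y, G y ∂μ) - inner ℝ b (∫ y, F y ∂μ) +
        ∫ y, inner ℝ (F y) (G y) ∂μ := by
  have haG : Integrable (fun y => inner ℝ a b - inner ℝ a (G y)) μ :=
    (integrable_const _).sub (hG.const_inner a)
  have hbF : Integrable (fun y => inner ℝ b (F y)) μ := hF.const_inner b
  simp only [inner_sub_sub_eq]
  rw [integral_add (haG.sub' hbF) hFG, integral_sub haG hbF,
    integral_sub (integrable_const _) (hG.const_inner a), integral_inner hG, integral_inner hF,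
    integral_const, probReal_univ, one_smul]

theorem integrable_integral_inner_sub_sub [CompleteSpace H] {F G : X → H} (hF : Integrable F μ)
    (hG : Integrable G μ) (hFG : Integrable (fun x => inner ℝ (F x) (G x)) μ) :
    Integrable (fun x => ∫ y, inner ℝ (F x - F y) (G x - G y) ∂μ) μ := by
  simp only [integral_inner_sub_sub hF hG hFG]
  exact ((hFG.sub (hF.inner_const _)).sub (hG.inner_const _)).add (integrable_const _)

theorem integral_integral_inner_sub_sub [CompleteSpace H] {F G : X → H} (hF : Integrable F μ)
    (hG : Integrable G μ) (hFG : Integrable (fun x => inner ℝ (F x) (G x)) μ) :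
    ∫ x, ∫ y, inner ℝ (F x - F y) (G x - G y) ∂μ ∂μ =
      2 * (∫ x, inner ℝ (F x) (G x) ∂μ - inner ℝ (∫ x, F x ∂μ) (∫ x, G x ∂μ)) := by
  have hFm : Integrable (fun x => inner ℝ (F x) (G x) - inner ℝ (F x) (∫ y, G y ∂μ)) μ :=
    hFG.sub (hF.inner_const _)
  have hGm : Integrable (fun x => inner ℝ (G x) (∫ y, F y ∂μ)) μ := hG.inner_const _
  have hmeans : ∫ x, inner ℝ (F x) (∫ y, G y ∂μ) ∂μ = inner ℝ (∫ x, F x ∂μ) (∫ x, G x ∂μ) := by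
    simp only [real_inner_comm (∫ y, G y ∂μ), integral_inner hF]
  have hmeans' : ∫ x, inner ℝ (G x) (∫ y, F y ∂μ) ∂μ = inner ℝ (∫ x, F x ∂μ) (∫ x, G x ∂μ) := by
    simp only [real_inner_comm (∫ y, F y ∂μ), integral_inner hG]
  simp only [integral_inner_sub_sub hF hG hFG]
  rw [integral_add (hFm.sub' hGm) (integrable_const _), integral_sub hFm hGm,
    integral_sub hFG (hF.inner_const _), hmeans, hmeans', integral_const, probReal_univ, one_smul]
  ring

theorem covariance_le_mul_covariance [CompleteSpace H] {F G V W : X → H} {C : ℝ}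
    (hF : Integrable F μ) (hG : Integrable G μ)
    (hFG : Integrable (fun x => inner ℝ (F x) (G x)) μ) (hV : Integrable V μ)
    (hW : Integrable W μ) (hVW : Integrable (fun x => inner ℝ (V x) (W x)) μ)
    (h : ∀ x y, inner ℝ (F x - F y) (G x - G y) ≤ C * inner ℝ (V x - V y) (W x - W y)) :
    ∫ x, inner ℝ (F x) (G x) ∂μ - inner ℝ (∫ x, F x ∂μ) (∫ x, G x ∂μ) ≤
      C * (∫ x, inner ℝ (V x) (W x) ∂μ - inner ℝ (∫ x, V x ∂μ) (∫ x, W x ∂μ)) := by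
  have hdouble : ∫ x, ∫ y, inner ℝ (F x - F y) (G x - G y) ∂μ ∂μ ≤
      ∫ x, ∫ y, C * inner ℝ (V x - V y) (W x - W y) ∂μ ∂μ := by
    refine integral_mono (integrable_integral_inner_sub_sub hF hG hFG) ?_ fun x =>
      integral_mono (integrable_inner_sub_sub hF hG hFG _ _)
        ((integrable_inner_sub_sub hV hW hVW _ _).const_mul C) fun y => h x y
    simpa only [integral_const_mul] using
      (integrable_integral_inner_sub_sub hV hW hVW).const_mul C
  simp only [integral_const_mul, integral_integral_inner_sub_sub hF hG hFG,
    integral_integral_inner_sub_sub hV hW hVW] at hdouble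
  linarith

theorem integral_norm_rpow_le_two_mul_variance [CompleteSpace H] {q : ℝ} (hq : 1 < q) {u : X → H}
    (hu : MemLp u (ENNReal.ofReal q) μ) (hmean : ∫ x, u x ∂μ = 0) :
    ∫ x, ‖u x‖ ^ q ∂μ ≤
      2 * (∫ x, ‖u x‖ ^ q ∂μ - ‖∫ x, radialPow (q / 2) (u x) ∂μ‖ ^ 2) := by
  have hq₀ : 0 < q := one_pos.trans hq
  have hu₁ : Integrable u μ := hu.integrable (ENNReal.one_le_ofReal.2 hq.le)
  have hJ := integrable_radialPow (sub_pos.2 hq) (sub_le_self q one_pos.le) hu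
  have hv := integrable_radialPow (half_pos hq₀) (half_le_self hq₀.le) hu
  have huq : Integrable (fun x => ‖u x‖ ^ q) μ := by
    simpa only [ENNReal.toReal_ofReal hq₀.le] using
      hu.integrable_norm_rpow (by simpa using hq₀) ENNReal.ofReal_ne_top
  have huJ : Integrable (fun x => inner ℝ (u x) (radialPow (q - 1) (u x))) μ := by
    simpa only [inner_radialPow_sub_one hq₀] using huq
  have hvv : Integrable
      (fun x => inner ℝ (radialPow (q / 2) (u x)) (radialPow (q / 2) (u x))) μ := by
    simpa only [real_inner_self_eq_norm_sq, norm_radialPow_half_sq hq₀] using huq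
  have hcov := covariance_le_mul_covariance hu₁ hJ huJ hv hv hvv (C := 2) fun x y => by
    simpa only [real_inner_self_eq_norm_sq] using
      inner_le_two_mul_norm_radialPow_half_sub_sq hq (u x) (u y)
  simpa only [inner_radialPow_sub_one hq₀, real_inner_self_eq_norm_sq, norm_radialPow_half_sq hq₀,
    hmean, inner_zero_left, sub_zero] using hcov

end RadialPowLp

section Torus

open Filter Topology UnitAddTorus

instance isProbabilityMeasure_torusMeasure (d : ℕ) : IsProbabilityMeasure (torusMeasure d) := by
  unfold torusMeasure; infer_instance

instance isAddLeftInvariant_torusMeasure (d : ℕ) : (torusMeasure d).IsAddLeftInvariant := by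
  unfold torusMeasure; infer_instance

variable {d : ℕ}

theorem mFourier_apply_add (n : Fin d → ℤ) (x y : UnitAddTorus (Fin d)) :
    mFourier n (x + y) = mFourier n x * mFourier n y := by
  simp only [mFourier, ContinuousMap.coe_mk, Pi.add_apply, fourier_apply, smul_add,
    AddCircle.toCircle_add, Circle.coe_mul, Finset.prod_mul_distrib]

theorem mFourier_apply_neg (n : Fin d → ℤ) (x : UnitAddTorus (Fin d)) :
    mFourier n (-x) = (starRingEnd ℂ) (mFourier n x) := by
  rw [← mFourier_neg]
  simp only [mFourier, ContinuousMap.coe_mk, Pi.neg_apply, fourier_apply, smul_neg, neg_smul]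

/-- The symbol of the second difference operator `2 - τ_y - τ_{-y}`, where `τ_y` is the
translation by `y`. -/
noncomputable def stepSymbol (y : UnitAddTorus (Fin d)) (n : Fin d → ℤ) : ℝ :=
  2 * (1 - (mFourier n y).re)

theorem norm_mFourier_apply_sub_one_sq (y : UnitAddTorus (Fin d)) (n : Fin d → ℤ) :
    ‖mFourier n y - 1‖ ^ 2 = stepSymbol y n := by
  rw [norm_sub_sq_real, norm_mFourier_apply, norm_one, stepSymbol, Complex.inner, one_mul,
    Complex.conj_re]
  ring

/-- The point of the torus at signed distance `h` from the origin along the `j`-th axis. -/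
noncomputable def axisPoint (j : Fin d) (h : ℝ) : UnitAddTorus (Fin d) :=
  Pi.single j (h : UnitAddCircle)

theorem mFourier_axisPoint_re (n : Fin d → ℤ) (j : Fin d) (h : ℝ) :
    (mFourier n (axisPoint j h)).re = Real.cos (2 * Real.pi * n j * h) := by
  rw [← Complex.exp_ofReal_mul_I_re]
  change (∏ i, fourier (n i) (axisPoint j h i)).re = _
  rw [Finset.prod_eq_single j]
  · rw [axisPoint, Pi.single_eq_same, fourier_coe_apply]
    congr 2
    push_cast
    ring
  · intro i _ hi
    rw [axisPoint, Pi.single_eq_of_ne hi, fourier_eval_zero]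
  · simp

/-- The symbol `(2π|n|)²` of `-Δ`. -/
noncomputable def laplaceSymbol (n : Fin d → ℤ) : ℝ := ∑ j, (2 * Real.pi * n j) ^ 2

theorem laplaceSymbol_nonneg (n : Fin d → ℤ) : 0 ≤ laplaceSymbol n :=
  Finset.sum_nonneg fun _ _ => sq_nonneg _

theorem sq_mul_freqNorm (n : Fin d → ℤ) : (2 * Real.pi * freqNorm n) ^ 2 = laplaceSymbol n := by
  rw [mul_pow, freqNorm, Real.sq_sqrt (Finset.sum_nonneg fun _ _ => sq_nonneg _), laplaceSymbol,
    Finset.mul_sum]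
  simp only [mul_pow]

theorem heatSymbol_eq_rpow (α t : ℝ) (n : Fin d → ℤ) :
    heatSymbol α t n = Real.exp (-(t * laplaceSymbol n ^ (α / 2))) := by
  have hnorm : 0 ≤ 2 * Real.pi * freqNorm n := mul_nonneg (by positivity) (Real.sqrt_nonneg _)
  rw [heatSymbol, ← sq_mul_freqNorm, ← Real.rpow_natCast_mul hnorm, Nat.cast_two,
    mul_div_cancel₀ α two_ne_zero]

theorem heatSymbol_two (t : ℝ) (n : Fin d → ℤ) :
    heatSymbol 2 t n = Real.exp (-(t * laplaceSymbol n)) := by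
  rw [heatSymbol_eq_rpow, div_self two_ne_zero, Real.rpow_one]

theorem four_pi_sq_le_laplaceSymbol {n : Fin d → ℤ} (hn : n ≠ 0) :
    4 * Real.pi ^ 2 ≤ laplaceSymbol n := by
  obtain ⟨j, hj⟩ := Function.ne_iff.mp hn
  have hone : (1 : ℝ) ≤ (n j : ℝ) ^ 2 := by
    exact_mod_cast Int.add_one_le_iff.2 (sq_pos_of_ne_zero (by simpa using hj))
  calc 4 * Real.pi ^ 2 ≤ (2 * Real.pi * n j) ^ 2 := by nlinarith [sq_nonneg Real.pi]
    _ ≤ laplaceSymbol n := Finset.single_le_sum (f := fun j => (2 * Real.pi * (n j : ℝ)) ^ 2)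
      (fun _ _ => sq_nonneg _) (Finset.mem_univ j)

theorem tendsto_two_mul_one_sub_cos_div_sq (a : ℝ) :
    Tendsto (fun h : ℝ => 2 * (1 - Real.cos (a * h)) / h ^ 2) (𝓝[≠] 0) (𝓝 (a ^ 2)) := by
  have hsin : HasDerivAt (fun h : ℝ => Real.sin (a / 2 * h)) (a / 2) 0 := by
    simpa using ((hasDerivAt_id (0 : ℝ)).const_mul (a / 2)).sin
  have hslope := ((hasDerivAt_iff_tendsto_slope.mp hsin).pow 2).const_mul 4
  rw [show 4 * (a / 2) ^ 2 = a ^ 2 by ring] at hslope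
  refine hslope.congr fun h => ?_
  have hcos : Real.cos (a * h) = 1 - 2 * Real.sin (a / 2 * h) ^ 2 := by
    rw [← Real.cos_two_mul_eq_one_sub, ← mul_assoc, mul_div_cancel₀ a two_ne_zero]
  simp only [slope_def_field, mul_zero, Real.sin_zero, sub_zero, hcos]
  ring

theorem tendsto_sum_stepSymbol_axisPoint (n : Fin d → ℤ) :
    Tendsto (fun h => ∑ j, stepSymbol (axisPoint j h) n / h ^ 2) (𝓝[≠] 0)
      (𝓝 (laplaceSymbol n)) := by
  simp only [stepSymbol, mFourier_axisPoint_re]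
  exact tendsto_finsetSum _ fun j _ => tendsto_two_mul_one_sub_cos_div_sq (2 * Real.pi * n j)

end Torus

section MonoLp

open Filter Topology UnitAddTorus

variable {d : ℕ}

theorem mFourierCoeff_congr_ae {f g : UnitAddTorus (Fin d) → ℂ} (h : f =ᵐ[torusMeasure d] g)
    (n : Fin d → ℤ) : mFourierCoeff f n = mFourierCoeff g n :=
  integral_congr_ae (h.mono fun x hx => congrArg (mFourier (-n) x • ·) hx)

theorem integrable_mFourier_smul {f : UnitAddTorus (Fin d) → ℂ}
    (hf : Integrable f (torusMeasure d)) (n : Fin d → ℤ) :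
    Integrable (fun x => mFourier n x • f x) (torusMeasure d) :=
  hf.bdd_smul 1 (mFourier n).continuous.aestronglyMeasurable
    (Eventually.of_forall fun x => (norm_mFourier_apply n x).le)

theorem mFourierCoeff_mFourier (m n : Fin d → ℤ) :
    mFourierCoeff (mFourier m) n = if n = m then 1 else 0 := by
  have h : mFourierCoeff (mFourier m) n = ∫ x, mFourier (-n + m) x ∂torusMeasure d :=
    integral_congr_ae (Eventually.of_forall fun x => mFourier_add.symm)
  rw [h, integral_mFourier]
  simp only [neg_add_eq_zero]

variable (q : ℝ≥0∞) [Fact (1 ≤ q)]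

/-- The monomial `mFourier n` as an element of `Lᵠ`. -/
noncomputable def monoLp (n : Fin d → ℤ) : Lp ℂ q (torusMeasure d) :=
  ContinuousMap.toLp q (torusMeasure d) ℂ (mFourier n)

theorem coeFn_monoLp (n : Fin d → ℤ) : monoLp q n =ᵐ[torusMeasure d] mFourier n :=
  ContinuousMap.coeFn_toLp _ _

theorem norm_monoLp_le (n : Fin d → ℤ) : ‖monoLp q n‖ ≤ 1 := by
  refine (Lp.norm_le_of_ae_bound (C := 1) zero_le_one ?_).trans_eq ?_
  · filter_upwards [coeFn_monoLp q n] with x hx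
    rw [hx, norm_mFourier_apply]
  · simp [measureUnivNNReal]

/-- The `n`-th Fourier coefficient as a continuous linear functional on `Lᵠ`. -/
noncomputable def coeffCLM (n : Fin d → ℤ) : Lp ℂ q (torusMeasure d) →L[ℂ] ℂ :=
  LinearMap.mkContinuous
    { toFun := fun f => mFourierCoeff f n
      map_add' := fun f g => by
        rw [mFourierCoeff_congr_ae (Lp.coeFn_add f g) n]
        simp only [mFourierCoeff, Pi.add_apply, smul_add]
        exact integral_add
          (integrable_mFourier_smul ((Lp.memLp f).integrable Fact.out) (-n))
          (integrable_mFourier_smul ((Lp.memLp g).integrable Fact.out) (-n))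
      map_smul' := fun z f => by
        rw [mFourierCoeff_congr_ae (Lp.coeFn_smul z f) n]
        simp only [mFourierCoeff, Pi.smul_apply, smul_comm _ z]
        exact integral_smul z _ }
    1 fun f => by
      rw [one_mul, Lp.norm_def]
      refine (norm_mFourierCoeff_le f n).trans ?_
      rw [integral_norm_eq_lintegral_enorm (Lp.memLp f).1, ← eLpNorm_one_eq_lintegral_enorm]
      exact ENNReal.toReal_mono (Lp.memLp f).2.ne
        (eLpNorm_le_eLpNorm_of_exponent_le Fact.out (Lp.memLp f).1)

theorem coeffCLM_apply (n : Fin d → ℤ) (f : Lp ℂ q (torusMeasure d)) :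
    coeffCLM q n f = mFourierCoeff f n := rfl

theorem norm_coeffCLM_le (n : Fin d → ℤ) : ‖coeffCLM (d := d) q n‖ ≤ 1 :=
  LinearMap.mkContinuous_norm_le _ zero_le_one _

theorem coeffCLM_monoLp (m n : Fin d → ℤ) :
    coeffCLM q n (monoLp q m) = if n = m then 1 else 0 := by
  rw [coeffCLM_apply, mFourierCoeff_congr_ae (coeFn_monoLp q m), mFourierCoeff_mFourier]

/-- Translation by `y` as an isometry of `Lᵠ`. -/
noncomputable def translateLp (y : UnitAddTorus (Fin d)) :
    Lp ℂ q (torusMeasure d) →ₗᵢ[ℂ] Lp ℂ q (torusMeasure d) :=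
  Lp.compMeasurePreservingₗᵢ ℂ (· + y) (measurePreserving_add_right (torusMeasure d) y)

theorem translateLp_monoLp (y : UnitAddTorus (Fin d)) (n : Fin d → ℤ) :
    translateLp q y (monoLp q n) = mFourier n y • monoLp q n := by
  have hy : MeasurePreserving (· + y) (torusMeasure d) (torusMeasure d) :=
    measurePreserving_add_right _ y
  refine Lp.ext ((Lp.coeFn_compMeasurePreserving (monoLp q n) hy).trans
    ((hy.quasiMeasurePreserving.ae_eq_comp (coeFn_monoLp q n)).trans ?_))
  filter_upwards [Lp.coeFn_smul (mFourier n y) (monoLp q n), coeFn_monoLp q n] with x hsmul hmono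
  rw [hsmul, Pi.smul_apply, hmono, smul_eq_mul, Function.comp_apply, mFourier_apply_add, mul_comm]

/-- The multiplier is the average of the translations by `y` and `-y`. -/
theorem multiplierBound_mFourier_apply_re (y : UnitAddTorus (Fin d)) (A : Set (Fin d → ℤ)) :
    MultiplierBound (monoLp q) A 1 (fun n => (mFourier n y).re) := by
  intro S _ c
  set g := ∑ n ∈ S, c n • monoLp q n with hg
  have havg : ∑ n ∈ S, (mFourier n y).re • c n • monoLp q n =
      (2⁻¹ : ℂ) • (translateLp q y g + translateLp q (-y) g) := by
    simp only [hg, map_sum, map_smul, translateLp_monoLp, mFourier_apply_neg,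
      ← Finset.sum_add_distrib, Finset.smul_sum]
    refine Finset.sum_congr rfl fun n _ => ?_
    rw [smul_comm (c n), smul_comm (c n), ← add_smul, Complex.add_conj, smul_smul,
      Complex.ofReal_mul, Complex.ofReal_ofNat, inv_mul_cancel_left₀ two_ne_zero]
    rfl
  calc ‖∑ n ∈ S, (mFourier n y).re • c n • monoLp q n‖
      = 2⁻¹ * ‖translateLp q y g + translateLp q (-y) g‖ := by
        rw [havg, norm_smul, norm_inv, Complex.norm_ofNat]
    _ ≤ 2⁻¹ * (‖g‖ + ‖g‖) := by
        gcongr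
        refine (norm_add_le _ _).trans_eq ?_
        rw [LinearIsometry.norm_map, LinearIsometry.norm_map]
    _ = 1 * ‖g‖ := by ring

theorem multiplierBound_exp_neg_laplaceSymbol {t : ℝ} (ht : 0 ≤ t) (A : Set (Fin d → ℤ)) :
    MultiplierBound (monoLp q) A 1 (fun n => Real.exp (-(t * laplaceSymbol n))) := by
  have hstep (h : ℝ) : MultiplierBound (monoLp q) A 1
      (fun n => Real.exp (-(t * ∑ j, stepSymbol (axisPoint j h) n / h ^ 2))) := by
    have hcos := MultiplierBound.finset_sum Finset.univ fun (j : Fin d) _ =>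
      multiplierBound_mFourier_apply_re q (axisPoint j h) A
    have hexp := hcos.exp_sub (s := 2 * t / h ^ 2) (by simp) (by positivity) (∑ _ : Fin d, 1)
    simp only [sub_self, mul_zero, Real.exp_zero, Finset.sum_apply, ← Finset.sum_sub_distrib]
      at hexp
    convert hexp using 3 with n
    simp only [stepSymbol, Finset.mul_sum, ← Finset.sum_neg_distrib]
    exact Finset.sum_congr rfl fun j _ => by ring
  exact .of_tendsto (l := 𝓝[≠] (0 : ℝ)) tendsto_const_nhds
    (fun n => ((tendsto_sum_stepSymbol_axisPoint n).const_mul t).neg.rexp)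
    (Eventually.of_forall hstep)

theorem tendsto_tsum_exp_neg_laplaceSymbol (d : ℕ) :
    Tendsto (fun l : ℝ => ∑' n : Fin d → ℤ,
      ({0}ᶜ : Set (Fin d → ℤ)).indicator (fun n => |Real.exp (-(l * laplaceSymbol n))|) n)
      atTop (𝓝 0) := by
  rw [← tsum_zero (α := ℝ) (β := Fin d → ℤ)]
  refine tendsto_tsum_of_dominated_convergence (summable_heatSymbol two_pos one_pos)
    (fun n => ?_) ?_
  · rcases eq_or_ne n 0 with rfl | hn
    · simp
    · have hpos : 0 < laplaceSymbol n :=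
        (by positivity : (0 : ℝ) < 4 * Real.pi ^ 2).trans_le (four_pi_sq_le_laplaceSymbol hn)
      simpa [hn] using tendsto_id.atTop_mul_const hpos
  · filter_upwards [eventually_ge_atTop 1] with l hl n
    rw [heatSymbol_two]
    refine (norm_indicator_le_norm_self _ n).trans ?_
    rw [Real.norm_eq_abs, abs_abs, Real.abs_exp]
    gcongr
    exact laplaceSymbol_nonneg n

theorem eventually_multiplierBound_exp_neg_laplaceSymbol (d : ℕ) :
    ∀ᶠ l : ℝ in atTop, ∀ (q : ℝ≥0∞) [Fact (1 ≤ q)],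
      MultiplierBound (monoLp (d := d) q) {0}ᶜ (1 / 2)
        (fun n => Real.exp (-(l * laplaceSymbol n))) := by
  filter_upwards [eventually_gt_atTop 0,
    (tendsto_tsum_exp_neg_laplaceSymbol d).eventually_le_const one_half_pos] with l hl hhalf q _
  have hs : Summable fun n : Fin d → ℤ => |Real.exp (-(l * laplaceSymbol n))| :=
    (summable_heatSymbol two_pos hl).congr fun n => by rw [heatSymbol_two, Real.abs_exp]
  exact (MultiplierBound.of_summable (norm_monoLp_le q) (norm_coeffCLM_le q)
    (fun i j => coeffCLM_monoLp q j i) (hs.indicator _)).mono hhalf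

theorem exists_multiplierBound_heatSymbol (d : ℕ) {α : ℝ} (hα : 0 < α) (hα₂ : α < 2) :
    ∃ c, 0 < c ∧ ∀ t, 0 < t → ∀ (q : ℝ≥0∞) [Fact (1 ≤ q)],
      MultiplierBound (monoLp (d := d) q) {0}ᶜ (Real.exp (-(c * t))) (heatSymbol α t) := by
  have hβ : α / 2 ∈ Set.Ioo 0 1 := ⟨half_pos hα, by linarith⟩
  obtain ⟨l₀, h⟩ := ((eventually_multiplierBound_exp_neg_laplaceSymbol d).and
    (eventually_gt_atTop 0)).exists_forall_of_atTop
  have hl₀ : 0 < l₀ := (h l₀ le_rfl).2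
  refine ⟨_, subordinateRate_exp_pos hβ hl₀, fun t ht q _ => ?_⟩
  have hexp := MultiplierBound.exp_neg_rpow_of_half hβ hl₀ ht.le laplaceSymbol_nonneg
    (fun l hl => multiplierBound_exp_neg_laplaceSymbol q hl.le _) fun l hl => (h l hl.le).1 q
  rw [mul_comm _ t, funext (heatSymbol_eq_rpow α t)]
  exact hexp

end MonoLp

section Dissipation

open Filter Topology UnitAddTorus

section Continuous

variable {X E : Type*} [TopologicalSpace X] [CompactSpace X] [MeasurableSpace X]
  [OpensMeasurableSpace X] [NormedAddCommGroup E] {μ : Measure X} [IsFiniteMeasureOnCompacts μ]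
  {f : X → E}

theorem memLp_of_continuous (hf : Continuous f) (p : ℝ≥0∞) : MemLp f p μ :=
  hf.memLp_of_hasCompactSupport (HasCompactSupport.of_compactSpace f)

theorem integrable_of_continuous (hf : Continuous f) : Integrable f μ :=
  hf.integrable_of_hasCompactSupport (HasCompactSupport.of_compactSpace f)

end Continuous

variable {d : ℕ}

theorem integral_inner_second_difference {H : Type*} [NormedAddCommGroup H]
    [InnerProductSpace ℝ H] {u w : UnitAddTorus (Fin d) → H} (hu : Continuous u)
    (hw : Continuous w) (y : UnitAddTorus (Fin d)) :
    ∫ x, inner ℝ (u x - u (x + y) + (u x - u (x - y))) (w x) ∂torusMeasure d =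
      ∫ x, inner ℝ (u (x + y) - u x) (w (x + y) - w x) ∂torusMeasure d := by
  have hshift : ∫ x, inner ℝ (u (x + y) - u x) (w (x + y)) ∂torusMeasure d =
      ∫ x, inner ℝ (u x - u (x - y)) (w x) ∂torusMeasure d := by
    rw [← integral_add_right_eq_self (fun x => inner ℝ (u x - u (x - y)) (w x)) y]
    simp only [add_sub_cancel_right]
  have hswap : ∫ x, inner ℝ (u (x + y) - u x) (w x) ∂torusMeasure d =
      -∫ x, inner ℝ (u x - u (x + y)) (w x) ∂torusMeasure d := by
    simp only [← integral_neg, ← inner_neg_left, neg_sub]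
  simp only [inner_add_left, inner_sub_right]
  rw [integral_add, integral_sub, hshift, hswap, sub_neg_eq_add, add_comm]
  all_goals exact integrable_of_continuous (by fun_prop)

theorem hasSum_sq_mFourierCoeff_of_continuous {v : UnitAddTorus (Fin d) → ℂ}
    (hv : Continuous v) :
    HasSum (fun n => ‖mFourierCoeff v n‖ ^ 2) (∫ x, ‖v x‖ ^ 2 ∂torusMeasure d) := by
  set V : Lp ℂ 2 (torusMeasure d) := ContinuousMap.toLp 2 (torusMeasure d) ℂ ⟨v, hv⟩
  have hV : V =ᵐ[torusMeasure d] v := ContinuousMap.coeFn_toLp _ _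
  have hnorm : ∫ x, ‖V x‖ ^ 2 ∂torusMeasure d = ∫ x, ‖v x‖ ^ 2 ∂torusMeasure d :=
    integral_congr_ae (hV.mono fun x hx => by simp only [hx])
  have hsum : HasSum (fun n => ‖mFourierCoeff V n‖ ^ 2) (∫ x, ‖V x‖ ^ 2 ∂torusMeasure d) :=
    hasSum_sq_mFourierCoeff V
  simpa only [mFourierCoeff_congr_ae hV, hnorm] using hsum

theorem mFourierCoeff_comp_add (v : UnitAddTorus (Fin d) → ℂ) (y : UnitAddTorus (Fin d))
    (n : Fin d → ℤ) :
    mFourierCoeff (fun x => v (x + y)) n = mFourier n y * mFourierCoeff v n := by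
  have hinv : mFourier n y * mFourier (-n) y = 1 := by
    rw [← mFourier_add, add_neg_cancel, mFourier_zero, ContinuousMap.one_apply]
  calc mFourierCoeff (fun x => v (x + y)) n
      = ∫ x, mFourier n y * (mFourier (-n) (x + y) • v (x + y)) ∂torusMeasure d := by
        refine integral_congr_ae (Eventually.of_forall fun x => ?_)
        simp only [smul_eq_mul, mFourier_apply_add]
        linear_combination (-(mFourier (-n) x * v (x + y))) * hinv
    _ = mFourier n y * ∫ x, mFourier (-n) x • v x ∂torusMeasure d := by
        rw [integral_const_mul,
          integral_add_right_eq_self (fun x => mFourier (-n) x • v x) y]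

theorem mFourierCoeff_comp_add_sub {v : UnitAddTorus (Fin d) → ℂ}
    (hv : Integrable v (torusMeasure d)) (y : UnitAddTorus (Fin d)) (n : Fin d → ℤ) :
    mFourierCoeff (fun x => v (x + y) - v x) n = (mFourier n y - 1) * mFourierCoeff v n := by
  rw [sub_mul, one_mul, ← mFourierCoeff_comp_add]
  simp only [mFourierCoeff, smul_sub]
  exact integral_sub (integrable_mFourier_smul (hv.comp_add_right y) (-n))
    (integrable_mFourier_smul hv (-n))

theorem sum_stepSymbol_mul_sq_mFourierCoeff_le {v : UnitAddTorus (Fin d) → ℂ}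
    (hv : Continuous v) (T : Finset (Fin d → ℤ)) (y : UnitAddTorus (Fin d)) :
    ∑ n ∈ T, stepSymbol y n * ‖mFourierCoeff v n‖ ^ 2 ≤
      ∫ x, ‖v (x + y) - v x‖ ^ 2 ∂torusMeasure d := by
  have hsum := hasSum_sq_mFourierCoeff_of_continuous (v := fun x => v (x + y) - v x) (by fun_prop)
  simp only [mFourierCoeff_comp_add_sub (integrable_of_continuous hv), norm_mul, mul_pow,
    norm_mFourier_apply_sub_one_sq] at hsum
  refine sum_le_hasSum T (fun n _ => ?_) hsum
  rw [← norm_mFourier_apply_sub_one_sq]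
  positivity

theorem sum_laplaceSymbol_mul_le_of_stepSymbol {a b : (Fin d → ℤ) → ℝ}
    {S T : Finset (Fin d → ℤ)}
    (h : ∀ y, ∑ n ∈ T, stepSymbol y n * a n ≤ ∑ n ∈ S, stepSymbol y n * b n) :
    ∑ n ∈ T, laplaceSymbol n * a n ≤ ∑ n ∈ S, laplaceSymbol n * b n := by
  have hlim (U : Finset (Fin d → ℤ)) (w : (Fin d → ℤ) → ℝ) :
      Tendsto (fun h : ℝ => ∑ n ∈ U, (∑ j, stepSymbol (axisPoint j h) n / h ^ 2) * w n) (𝓝[≠] 0)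
        (𝓝 (∑ n ∈ U, laplaceSymbol n * w n)) :=
    tendsto_finsetSum U fun n _ => (tendsto_sum_stepSymbol_axisPoint n).mul_const _
  have hswap (h : ℝ) (U : Finset (Fin d → ℤ)) (w : (Fin d → ℤ) → ℝ) :
      ∑ n ∈ U, (∑ j, stepSymbol (axisPoint j h) n / h ^ 2) * w n =
        ∑ j, (∑ n ∈ U, stepSymbol (axisPoint j h) n * w n) / h ^ 2 := by
    simp only [Finset.sum_mul, Finset.sum_div, div_mul_eq_mul_div]
    exact Finset.sum_comm
  refine le_of_tendsto_of_tendsto' (hlim T a) (hlim S b) fun t => ?_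
  rw [hswap, hswap]
  gcongr with j
  exact h _

theorem four_pi_sq_mul_variance_le {v : UnitAddTorus (Fin d) → ℂ} (hv : Continuous v) {B : ℝ}
    (h : ∀ T : Finset (Fin d → ℤ), ∑ n ∈ T, laplaceSymbol n * ‖mFourierCoeff v n‖ ^ 2 ≤ B) :
    4 * Real.pi ^ 2 *
      (∫ x, ‖v x‖ ^ 2 ∂torusMeasure d - ‖∫ x, v x ∂torusMeasure d‖ ^ 2) ≤ B := by
  have hmean : mFourierCoeff v 0 = ∫ x, v x ∂torusMeasure d :=
    integral_congr_ae (Eventually.of_forall fun x => by simp [mFourier_zero])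
  have hvar := ((hasSum_sq_mFourierCoeff_of_continuous hv).update 0 0).mul_left (4 * Real.pi ^ 2)
  rw [hmean, zero_sub, neg_add_eq_sub] at hvar
  refine hasSum_le_of_sum_le hvar fun T => (Finset.sum_le_sum fun n _ => ?_).trans (h T)
  rcases eq_or_ne n 0 with rfl | hn
  · rw [Function.update_self, mul_zero]
    exact mul_nonneg (laplaceSymbol_nonneg _) (sq_nonneg _)
  · rw [Function.update_of_ne hn]
    exact mul_le_mul_of_nonneg_right (four_pi_sq_le_laplaceSymbol hn) (sq_nonneg _)

/-- The trigonometric polynomial with coefficients `c` and frequencies in `S`. -/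
noncomputable def trigPoly (S : Finset (Fin d → ℤ)) (c : (Fin d → ℤ) → ℂ) :
    C(UnitAddTorus (Fin d), ℂ) :=
  ∑ n ∈ S, c n • mFourier n

theorem trigPoly_apply (S : Finset (Fin d → ℤ)) (c : (Fin d → ℤ) → ℂ) (x : UnitAddTorus (Fin d)) :
    trigPoly S c x = ∑ n ∈ S, c n * mFourier n x := by
  simp only [trigPoly, ContinuousMap.sum_apply, ContinuousMap.smul_apply, smul_eq_mul]

theorem integral_trigPoly {S : Finset (Fin d → ℤ)} (hS : (S : Set (Fin d → ℤ)) ⊆ {0}ᶜ)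
    (c : (Fin d → ℤ) → ℂ) : ∫ x, trigPoly S c x ∂torusMeasure d = 0 := by
  simp only [trigPoly_apply]
  rw [integral_finsetSum _ fun n _ => integrable_of_continuous (by fun_prop)]
  refine Finset.sum_eq_zero fun n hn => ?_
  rw [integral_const_mul, integral_mFourier, if_neg (show n ≠ 0 from hS hn), mul_zero]

theorem second_difference_trigPoly (S : Finset (Fin d → ℤ)) (c : (Fin d → ℤ) → ℂ)
    (x y : UnitAddTorus (Fin d)) :
    trigPoly S c x - trigPoly S c (x + y) + (trigPoly S c x - trigPoly S c (x - y)) =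
      trigPoly S (fun n => stepSymbol y n • c n) x := by
  simp only [trigPoly_apply, ← Finset.sum_sub_distrib, ← Finset.sum_add_distrib]
  refine Finset.sum_congr rfl fun n _ => ?_
  have hre := Complex.add_conj (mFourier n y)
  rw [sub_eq_add_neg x y, mFourier_apply_add, mFourier_apply_add, mFourier_apply_neg, stepSymbol,
    Complex.real_smul]
  push_cast at hre ⊢
  linear_combination (-(c n * mFourier n x)) * hre

theorem integral_inner_trigPoly_smul {w : UnitAddTorus (Fin d) → ℂ} (hw : Continuous w)
    (S : Finset (Fin d → ℤ)) (s : (Fin d → ℤ) → ℝ) (c : (Fin d → ℤ) → ℂ) :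
    ∫ x, inner ℝ (trigPoly S (fun n => s n • c n) x) (w x) ∂torusMeasure d =
      ∑ n ∈ S, s n * ∫ x, inner ℝ (c n * mFourier n x) (w x) ∂torusMeasure d := by
  simp only [trigPoly_apply, smul_mul_assoc, sum_inner, real_inner_smul_left]
  rw [integral_finsetSum _ fun n _ => integrable_of_continuous (by fun_prop)]
  simp only [integral_const_mul]

variable {q : ℝ}

theorem mul_sum_stepSymbol_le_dissipation (hq : 1 < q) (S T : Finset (Fin d → ℤ))
    (c : (Fin d → ℤ) → ℂ) (y : UnitAddTorus (Fin d)) :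
    4 * (q - 1) / q ^ 2 * ∑ n ∈ T, stepSymbol y n *
        ‖mFourierCoeff (fun x => radialPow (q / 2) (trigPoly S c x)) n‖ ^ 2 ≤
      ∫ x, inner ℝ (trigPoly S (fun n => stepSymbol y n • c n) x)
        (radialPow (q - 1) (trigPoly S c x)) ∂torusMeasure d := by
  have hJ : Continuous fun x => radialPow (q - 1) (trigPoly S c x) :=
    (continuous_radialPow (sub_pos.2 hq)).comp (trigPoly S c).continuous
  have hv : Continuous fun x => radialPow (q / 2) (trigPoly S c x) :=
    (continuous_radialPow (by linarith)).comp (trigPoly S c).continuous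
  have hk : 0 ≤ 4 * (q - 1) / q ^ 2 := by
    have := sub_pos.2 hq
    positivity
  refine (mul_le_mul_of_nonneg_left
    (sum_stepSymbol_mul_sq_mFourierCoeff_le hv T y) hk).trans ?_
  simp only [← second_difference_trigPoly]
  rw [integral_inner_second_difference (trigPoly S c).continuous hJ, ← integral_const_mul]
  have hJy : Continuous fun x => radialPow (q - 1) (trigPoly S c (x + y)) :=
    hJ.comp (continuous_add_const y)
  have hvy : Continuous fun x => radialPow (q / 2) (trigPoly S c (x + y)) :=
    hv.comp (continuous_add_const y)
  exact integral_mono (integrable_of_continuous (by fun_prop))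
    (integrable_of_continuous (by fun_prop))
    fun x => norm_radialPow_half_sub_sq_le_inner hq _ _

theorem mul_sum_laplaceSymbol_le_dissipation (hq : 1 < q) (S T : Finset (Fin d → ℤ))
    (c : (Fin d → ℤ) → ℂ) :
    4 * (q - 1) / q ^ 2 * ∑ n ∈ T, laplaceSymbol n *
        ‖mFourierCoeff (fun x => radialPow (q / 2) (trigPoly S c x)) n‖ ^ 2 ≤
      ∫ x, inner ℝ (trigPoly S (fun n => laplaceSymbol n • c n) x)
        (radialPow (q - 1) (trigPoly S c x)) ∂torusMeasure d := by
  have hJ : Continuous fun x => radialPow (q - 1) (trigPoly S c x) :=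
    (continuous_radialPow (sub_pos.2 hq)).comp (trigPoly S c).continuous
  have hstep := mul_sum_stepSymbol_le_dissipation hq S T c
  simp only [integral_inner_trigPoly_smul hJ, Finset.mul_sum, mul_left_comm _ (stepSymbol _ _)]
    at hstep
  simpa only [integral_inner_trigPoly_smul hJ, Finset.mul_sum, mul_left_comm _ (laplaceSymbol _)]
    using sum_laplaceSymbol_mul_le_of_stepSymbol hstep

theorem mul_integral_norm_rpow_le_dissipation (hq : 1 < q) {S : Finset (Fin d → ℤ)}
    (hS : (S : Set (Fin d → ℤ)) ⊆ {0}ᶜ) (c : (Fin d → ℤ) → ℂ) :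
    8 * Real.pi ^ 2 * ((q - 1) / q ^ 2) * ∫ x, ‖trigPoly S c x‖ ^ q ∂torusMeasure d ≤
      ∫ x, inner ℝ (trigPoly S (fun n => laplaceSymbol n • c n) x)
        (radialPow (q - 1) (trigPoly S c x)) ∂torusMeasure d := by
  set D := ∫ x, inner ℝ (trigPoly S (fun n => laplaceSymbol n • c n) x)
    (radialPow (q - 1) (trigPoly S c x)) ∂torusMeasure d
  have : 0 < q - 1 := sub_pos.2 hq
  have hk : 0 < 4 * (q - 1) / q ^ 2 := by positivity
  have hv : Continuous fun x => radialPow (q / 2) (trigPoly S c x) :=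
    (continuous_radialPow (by linarith)).comp (trigPoly S c).continuous
  have hpoincare := four_pi_sq_mul_variance_le hv (B := D / (4 * (q - 1) / q ^ 2)) fun T => by
    rw [le_div_iff₀' hk]
    exact mul_sum_laplaceSymbol_le_dissipation hq S T c
  simp only [norm_radialPow_half_sq (one_pos.trans hq)] at hpoincare
  have hvariance := integral_norm_rpow_le_two_mul_variance hq
    (memLp_of_continuous (μ := torusMeasure d) (trigPoly S c).continuous _)
    (integral_trigPoly hS c)
  calc _ ≤ 8 * Real.pi ^ 2 * ((q - 1) / q ^ 2) * _ :=
        mul_le_mul_of_nonneg_left hvariance (by positivity)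
    _ = 4 * (q - 1) / q ^ 2 * (4 * Real.pi ^ 2 * _) := by ring
    _ ≤ D := (le_div_iff₀' hk).1 hpoincare

theorem norm_sum_smul_monoLp (hq : 0 < q) [Fact (1 ≤ ENNReal.ofReal q)]
    (S : Finset (Fin d → ℤ)) (c : (Fin d → ℤ) → ℂ) :
    ‖∑ n ∈ S, c n • monoLp (ENNReal.ofReal q) n‖ =
      (∫ x, ‖trigPoly S c x‖ ^ q ∂torusMeasure d) ^ (1 / q) := by
  have htoLp : ∑ n ∈ S, c n • monoLp (ENNReal.ofReal q) n =
      ContinuousMap.toLp (ENNReal.ofReal q) (torusMeasure d) ℂ (trigPoly S c) := by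
    simp only [trigPoly, map_sum, map_smul, monoLp]
  rw [htoLp, Lp.norm_def, eLpNorm_congr_ae (ContinuousMap.coeFn_toLp _ _),
    (memLp_of_continuous (trigPoly S c).continuous _).eLpNorm_eq_integral_rpow_norm
      (by simpa using hq) ENNReal.ofReal_ne_top,
    ENNReal.toReal_ofReal hq.le, ENNReal.toReal_ofReal (by positivity), one_div]

theorem multiplierBound_resolvent (hq : 1 < q) [Fact (1 ≤ ENNReal.ofReal q)] {r : ℝ}
    (hr : 0 < r) :
    MultiplierBound (monoLp (d := d) (ENNReal.ofReal q)) {0}ᶜ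
      (r / (r + 8 * Real.pi ^ 2 * ((q - 1) / q ^ 2))) (fun n => r / (r + laplaceSymbol n)) := by
  intro S hS c
  have hq₁ : 0 < q - 1 := sub_pos.2 hq
  set κ := 8 * Real.pi ^ 2 * ((q - 1) / q ^ 2)
  have : 0 ≤ κ := by positivity
  set b : (Fin d → ℤ) → ℂ := fun n => (r / (r + laplaceSymbol n)) • c n with hb
  have hsplit (n : Fin d → ℤ) : r • c n = r • b n + laplaceSymbol n • b n := by
    have hne : r + laplaceSymbol n ≠ 0 := (add_pos_of_pos_of_nonneg hr (laplaceSymbol_nonneg n)).ne'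
    rw [← add_smul, hb, smul_smul, mul_div_cancel₀ r hne]
  have hdecomp (x : UnitAddTorus (Fin d)) : r • trigPoly S c x =
      r • trigPoly S b x + trigPoly S (fun n => laplaceSymbol n • b n) x := by
    simp only [trigPoly_apply, Finset.smul_sum, ← Finset.sum_add_distrib, ← smul_mul_assoc,
      ← add_mul, hsplit]
  have hJ : Continuous fun x => radialPow (q - 1) (trigPoly S b x) :=
    (continuous_radialPow hq₁).comp (trigPoly S b).continuous
  have hcoercive : (r + κ) / r * ∫ x, ‖trigPoly S b x‖ ^ q ∂torusMeasure d ≤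
      ∫ x, inner ℝ (trigPoly S c x) (radialPow (q - 1) (trigPoly S b x)) ∂torusMeasure d := by
    rw [div_mul_eq_mul_div, div_le_iff₀' hr, ← integral_const_mul r]
    simp only [← real_inner_smul_left, hdecomp, inner_add_left]
    rw [integral_add (integrable_of_continuous (by fun_prop))
      (integrable_of_continuous (by fun_prop)), add_mul]
    simp only [real_inner_smul_left, inner_radialPow_sub_one (one_pos.trans hq),
      integral_const_mul]
    exact add_le_add_right (mul_integral_norm_rpow_le_dissipation hq hS b) _
  have hHolder := mul_rpow_integral_norm_rpow_le hq
    (memLp_of_continuous (trigPoly S c).continuous _)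
    (memLp_of_continuous (trigPoly S b).continuous _) hcoercive
  simp only [← smul_assoc]
  change ‖∑ n ∈ S, b n • _‖ ≤ _
  rw [norm_sum_smul_monoLp (one_pos.trans hq), norm_sum_smul_monoLp (one_pos.trans hq)]
  rwa [← inv_div (r + κ) r, ← div_eq_inv_mul, le_div_iff₀' (by positivity)]

theorem multiplierBound_heatSymbol_two (hq : 1 < q) [Fact (1 ≤ ENNReal.ofReal q)] {t : ℝ}
    (ht : 0 < t) :
    MultiplierBound (monoLp (d := d) (ENNReal.ofReal q)) {0}ᶜ
      (Real.exp (-(8 * Real.pi ^ 2 * ((q - 1) / q ^ 2) * t))) (heatSymbol 2 t) := by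
  have hκ : 0 ≤ 8 * Real.pi ^ 2 * ((q - 1) / q ^ 2) := by
    have := sub_pos.2 hq
    positivity
  rw [mul_comm _ t, funext (heatSymbol_two t)]
  exact .exp_neg_of_resolvent hκ laplaceSymbol_nonneg ht fun r hr => multiplierBound_resolvent hq hr

end Dissipation

section FracHeat

open Filter Topology UnitAddTorus

theorem eLpNorm_top_le_of_forall_nat {X ε : Type*} [MeasurableSpace X] [TopologicalSpace ε]
    [ContinuousENorm ε] {μ : Measure X} {f : X → ε} (hf : AEStronglyMeasurable f μ) {K : ℝ≥0∞}
    (h : ∀ p : ℕ, p ≠ 0 → eLpNorm f p μ ≤ K) : eLpNorm f ∞ μ ≤ K := by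
  refine le_of_forall_gt_imp_ge_of_dense fun r hr => ?_
  rcases eq_or_ne r ∞ with rfl | hr_top
  · exact le_top
  have hr₀ : r ≠ 0 := hr.ne_bot
  have hratio : r⁻¹ * K < 1 := by
    rwa [← ENNReal.div_eq_inv_mul, ENNReal.div_lt_iff (.inl hr₀) (.inl hr_top), one_mul]
  have hmarkov : ∀ᶠ p : ℕ in atTop, μ {x | r ≤ ‖f x‖ₑ} ≤ (r⁻¹ * K) ^ p := by
    filter_upwards [eventually_ne_atTop 0] with p hp
    refine (meas_ge_le_mul_pow_eLpNorm_enorm μ (Nat.cast_ne_zero.2 hp) (ENNReal.natCast_ne_top p)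
      hf hr₀ (absurd · hr_top)).trans ?_
    rw [ENNReal.toReal_natCast, ENNReal.rpow_natCast, ENNReal.rpow_natCast, ← mul_pow]
    gcongr
    exact h p hp
  have hnull : μ {x | r ≤ ‖f x‖ₑ} = 0 := le_zero_iff.1 <|
    ge_of_tendsto (ENNReal.tendsto_pow_atTop_nhds_zero_of_lt_one hratio) hmarkov
  rw [eLpNorm_exponent_top]
  refine eLpNormEssSup_le_of_ae_enorm_bound ?_
  filter_upwards [measure_eq_zero_iff_ae_notMem.1 hnull] with x hx
  exact (not_le.1 hx).le

variable {d : ℕ} {α t : ℝ}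

theorem fracHeat_congr_ae {f g : UnitAddTorus (Fin d) → ℂ} (h : f =ᵐ[torusMeasure d] g) :
    fracHeat α t f = fracHeat α t g := by
  funext x
  simp only [fracHeat, mFourierCoeff_congr_ae h]

theorem coe_tsum_smul_mFourier (hα : 0 < α) (ht : 0 < t) (f : UnitAddTorus (Fin d) → ℂ) :
    ⇑(∑' n, ((heatSymbol α t n : ℂ) * mFourierCoeff f n) • mFourier n) = fracHeat α t f :=
  funext fun x => (ContinuousMap.tsum_apply (summable_norm_fracHeat hα ht f).of_norm x).symm

theorem memLp_fracHeat (hα : 0 < α) (ht : 0 < t) (f : UnitAddTorus (Fin d) → ℂ) (q : ℝ≥0∞) :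
    MemLp (fracHeat α t f) q (torusMeasure d) := by
  rw [← coe_tsum_smul_mFourier hα ht f]
  exact memLp_of_continuous (ContinuousMap.continuous _) q

section HeatCLM

variable (q : ℝ≥0∞) [Fact (1 ≤ q)]

/-- The operator `e^{-t|∇|^α}` on `Lᵠ`, as the sum of its rank one spectral components. The series
converges in operator norm, hence is not a junk value, when `0 < α` and `0 < t`. -/
noncomputable def heatCLM (d : ℕ) (α t : ℝ) :
    Lp ℂ q (torusMeasure d) →L[ℂ] Lp ℂ q (torusMeasure d) :=
  ∑' n : Fin d → ℤ, (heatSymbol α t n : ℂ) • (coeffCLM q n).smulRight (monoLp q n)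

theorem hasSum_heatCLM_apply (hα : 0 < α) (ht : 0 < t) (g : Lp ℂ q (torusMeasure d)) :
    HasSum (fun n => ((heatSymbol α t n : ℂ) * mFourierCoeff g n) • monoLp q n)
      (heatCLM q d α t g) := by
  have hs : Summable fun n : Fin d → ℤ =>
      (heatSymbol α t n : ℂ) • (coeffCLM q n).smulRight (monoLp q n) := by
    refine .of_norm_bounded (summable_heatSymbol hα ht) fun n => ?_
    rw [norm_smul, Complex.norm_real, Real.norm_of_nonneg (heatSymbol_pos α t n).le,
      ContinuousLinearMap.norm_smulRight_apply]
    exact mul_le_of_le_one_right (heatSymbol_pos α t n).le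
      (mul_le_one₀ (norm_coeffCLM_le q n) (norm_nonneg _) (norm_monoLp_le q n))
  simp only [mul_smul]
  exact hs.hasSum.mapL (ContinuousLinearMap.apply ℂ _ g)

theorem coeFn_heatCLM (hα : 0 < α) (ht : 0 < t) (g : Lp ℂ q (torusMeasure d)) :
    heatCLM q d α t g =ᵐ[torusMeasure d] fracHeat α t g := by
  have hsum := (summable_norm_fracHeat hα ht g).of_norm.hasSum.mapL
    (ContinuousMap.toLp q (torusMeasure d) ℂ)
  simp only [map_smul] at hsum
  rw [(hasSum_heatCLM_apply q hα ht g).unique hsum, ← coe_tsum_smul_mFourier hα ht g]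
  exact ContinuousMap.coeFn_toLp _ _

theorem heatCLM_monoLp (hα : 0 < α) (ht : 0 < t) (m : Fin d → ℤ) :
    heatCLM q d α t (monoLp q m) = heatSymbol α t m • monoLp q m := by
  refine (hasSum_heatCLM_apply q hα ht (monoLp q m)).unique ?_
  simp only [← coeffCLM_apply, coeffCLM_monoLp]
  convert hasSum_single m fun n hn => ?_ using 1
  · rw [if_pos rfl, mul_one]
    rfl
  · rw [if_neg hn, mul_zero, zero_smul]

end HeatCLM

theorem eLpNorm_fracHeat_le_of_ne_top {q : ℝ≥0∞} [Fact (1 ≤ q)] (hq : q ≠ ∞) (hα : 0 < α)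
    (ht : 0 < t) {κ : ℝ} (h : MultiplierBound (monoLp (d := d) q) {0}ᶜ κ (heatSymbol α t))
    {f : UnitAddTorus (Fin d) → ℂ} (hf : MemLp f q (torusMeasure d))
    (hmean : mFourierCoeff f 0 = 0) :
    eLpNorm (fracHeat α t f) q (torusMeasure d) ≤
      ENNReal.ofReal κ * eLpNorm f q (torusMeasure d) := by
  set g : Lp ℂ q (torusMeasure d) := hf.toLp f
  have hgf : g =ᵐ[torusMeasure d] f := hf.coeFn_toLp
  have hdense : Dense
      (Submodule.span ℂ (Set.range (monoLp (d := d) q)) : Set (Lp ℂ q (torusMeasure d))) :=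
    Submodule.dense_iff_topologicalClosure_eq_top.2 (span_mFourierLp_closure_eq_top hq)
  have hmem := mem_closure_span_image_compl hdense (fun n => coeffCLM_monoLp q n 0)
    ((mFourierCoeff_congr_ae hgf 0).trans hmean)
  have hbound : ‖heatCLM q d α t g‖ ≤ κ * ‖g‖ :=
    h.norm_map_le (fun n _ => heatCLM_monoLp q hα ht n) hmem
  calc eLpNorm (fracHeat α t f) q (torusMeasure d)
      = ‖heatCLM q d α t g‖ₑ := by
        rw [Lp.enorm_def, eLpNorm_congr_ae (coeFn_heatCLM q hα ht g), fracHeat_congr_ae hgf]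
    _ ≤ ENNReal.ofReal κ * ‖g‖ₑ := by
        rw [← ofReal_norm, ← ofReal_norm, ← ENNReal.ofReal_mul' (norm_nonneg _)]
        exact ENNReal.ofReal_le_ofReal hbound
    _ = ENNReal.ofReal κ * eLpNorm f q (torusMeasure d) := by
        rw [Lp.enorm_def, eLpNorm_congr_ae hgf]

/-- Trigonometric polynomials are not dense in `L^∞`, so `q = ∞` is reached as a limit. -/
theorem eLpNorm_fracHeat_le (hα : 0 < α) (ht : 0 < t) {κ : ℝ}
    (h : ∀ (q : ℝ≥0∞) [Fact (1 ≤ q)],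
      MultiplierBound (monoLp (d := d) q) {0}ᶜ κ (heatSymbol α t))
    (q : ℝ≥0∞) [Fact (1 ≤ q)] {f : UnitAddTorus (Fin d) → ℂ} (hf : MemLp f q (torusMeasure d))
    (hmean : mFourierCoeff f 0 = 0) :
    eLpNorm (fracHeat α t f) q (torusMeasure d) ≤
      ENNReal.ofReal κ * eLpNorm f q (torusMeasure d) := by
  rcases eq_or_ne q ∞ with rfl | hq
  · refine eLpNorm_top_le_of_forall_nat (memLp_fracHeat hα ht f ∞).1 fun p hp => ?_
    have : Fact ((1 : ℝ≥0∞) ≤ p) := ⟨by exact_mod_cast Nat.one_le_iff_ne_zero.2 hp⟩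
    refine (eLpNorm_fracHeat_le_of_ne_top (ENNReal.natCast_ne_top p) hα ht (h p)
      (hf.mono_exponent le_top) hmean).trans ?_
    gcongr
    exact eLpNorm_le_eLpNorm_of_exponent_le le_top hf.1
  · exact eLpNorm_fracHeat_le_of_ne_top hq hα ht (h q) hf hmean

end FracHeat

end PeriodicHeat

theorem theorem1p3 :
    (∀ d : ℕ, 1 ≤ d → ∀ α : ℝ, 0 < α → α < 2 →
      ∃ c₁ : ℝ, 0 < c₁ ∧
        ∀ q : ℝ≥0∞, 1 ≤ q → ∀ f : UnitAddTorus (Fin d) → ℂ,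
          MemLp f q (PeriodicHeat.torusMeasure d) →
          UnitAddTorus.mFourierCoeff f 0 = 0 →
          ∀ t : ℝ, 0 < t →
            MemLp (PeriodicHeat.fracHeat α t f) q (PeriodicHeat.torusMeasure d) ∧
            eLpNorm (PeriodicHeat.fracHeat α t f) q (PeriodicHeat.torusMeasure d) ≤
              ENNReal.ofReal (Real.exp (-(c₁ * t))) *
                eLpNorm f q (PeriodicHeat.torusMeasure d)) ∧
    (∃ c₂ : ℝ, 0 < c₂ ∧
      ∀ d : ℕ, 1 ≤ d → ∀ q : ℝ, 1 < q → ∀ f : UnitAddTorus (Fin d) → ℂ,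
        MemLp f (ENNReal.ofReal q) (PeriodicHeat.torusMeasure d) →
        UnitAddTorus.mFourierCoeff f 0 = 0 →
        ∀ t : ℝ, 0 < t →
          MemLp (PeriodicHeat.fracHeat 2 t f) (ENNReal.ofReal q)
            (PeriodicHeat.torusMeasure d) ∧
          eLpNorm (PeriodicHeat.fracHeat 2 t f) (ENNReal.ofReal q)
              (PeriodicHeat.torusMeasure d) ≤
            ENNReal.ofReal (Real.exp (-(c₂ * ((q - 1) / q ^ 2) * t))) *
              eLpNorm f (ENNReal.ofReal q) (PeriodicHeat.torusMeasure d)) := by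
  refine ⟨fun d _ α hα hα₂ => ?_, 8 * Real.pi ^ 2, by positivity,
    fun d _ q hq f hf hmean t ht => ?_⟩
  · obtain ⟨c, hc, hbound⟩ := PeriodicHeat.exists_multiplierBound_heatSymbol d hα hα₂
    refine ⟨c, hc, fun q hq f hf hmean t ht => ?_⟩
    have : Fact (1 ≤ q) := ⟨hq⟩
    exact ⟨PeriodicHeat.memLp_fracHeat hα ht f q,
      PeriodicHeat.eLpNorm_fracHeat_le hα ht (hbound t ht) q hf hmean⟩
  · have : Fact (1 ≤ ENNReal.ofReal q) := ⟨ENNReal.one_le_ofReal.2 hq.le⟩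
    exact ⟨PeriodicHeat.memLp_fracHeat two_pos ht f _,
      PeriodicHeat.eLpNorm_fracHeat_le_of_ne_top ENNReal.ofReal_ne_top two_pos ht
        (PeriodicHeat.multiplierBound_heatSymbol_two hq ht) hf hmean⟩
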